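/- Let $\mathbf{O}$ be the Cayley octonions, with basis $e_0=1,e_1,\dots,e_7$, where $e_i^2=-e_0$ and $e_ie_j=-e_je_i$ for distinct $i,j\ge 1$, $e_2e_6=e_3e_4=e_5e_7=e_1$, together with all relations obtained by cyclically permuting the indices $1,\dots,7$. Let $\mathcal J=\{M\in M_3(\mathbf{O}) : M^*=M\}$ with the Jordan product $M\star N=\frac12(MN+NM)$, and let $$\det\begin{pmatrix}\xi_1&x_3&\overline{x}_2\\ \overline{x}_3&\xi_2&x_1\\ x_2&\overline{x}_1&\xi_3\end{pmatrix}=\xi_1\xi_2\xi_3-\sum_{i=1}^3\xi_i|x_i|^2+2\,\mathrm{Re}(x_1x_2x_3).$$ Let $E_{6(-26)}=\{g\in GL(\mathcal J) : \det\circ g=\det\}$ and $F_{4(-52)}=\{g\in E_{6(-26)} : g(I)=I\}$. An element of $\mathcal J$ is called positive if it can be moved by an element of $F_{4(-52)}$ to a diagonal matrix with positive diagonal entries. As a model of $E_{6(-26)}/F_{4(-52)}$ take $$X_{\mathbf O}=\{M\in\mathcal J : \det M=1,\ M \text{ positive}\},$$ on which $g\in E_{6(-26)}$ acts by letting $g\circ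 M$ be the element $N\in X_{\mathbf O}$ with $N\star N=g(M\star M)$. The distance on $X_{\mathbf O}$ is $d_{\mathbf O}(M,N)=\log\max_i d_i+\log\max_i d_i^{-1}$, where $M=g\circ I$ and $N=g\circ D$ with $g\in E_{6(-26)}$ and $D\in X_{\mathbf O}$ diagonal with entries $d_1,d_2,d_3>0$. Let $X_{\mathbf C}$ be the set of positive definite Hermitian matrices in $SL_3(\mathbf C)$, a model of $SL_3(\mathbf C)/SU_3(\mathbf C)$, with the action $g(z)=(gz^2g^*)^{1/2}$ of $SL_3(\mathbf C)$ and the distance $d_{\mathbf C}(x,y)=\log\|x^{-1}y\|+\log\|y^{-1}x\|$, where $\|\cdot\|$ is the operator norm on $\mathbf{C}^3$. Call the curves $t\mapsto g\circ e^{tH}$ (respectively $t\mapsto g(e^{tH})$), with $g\in E_{6(-26)}$ (respectively $g\in SL_3(\mathbf C)$) and $H$ a real diagonal matrix of trace $0$, the geodesic lines of $X_{\mathbf O}$ (respectively $X_{\mathbf C}$); they are the geodesics of the symmetric space, constant curves included. A map $\varphi:X_{\mathbf C}\to X_{\mathbf O}$ is called a totally geodesic embedding if 1. $d_{\mathbf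 O}(\varphi(x),\varphi(y))=d_{\mathbf C}(x,y)$ for all $x,y\in X_{\mathbf C}$; 2. $\varphi\circ\gamma$ is a geodesic line of $X_{\mathbf O}$ for every geodesic line $\gamma$ of $X_{\mathbf C}$; 3. the image of $\varphi$ contains every geodesic segment joining two of its points, that is, the image of every map $\gamma:[0,L]\to X_{\mathbf O}$ with $L\ge 0$, $\gamma(0),\gamma(L)\in\varphi(X_{\mathbf C})$ and $d_{\mathbf O}(\gamma(s),\gamma(t))=|s-t|$ for all $s,t\in[0,L]$. **Proposition.** For any three points $x,y,z\in X_{\mathbf O}$ there is a totally geodesic embedding $\varphi:X_{\mathbf C}\to X_{\mathbf O}$ whose image contains $x$, $y$ and $z$. -/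

import Mathlib

noncomputable section

namespace FreudenthalE6

open scoped ComplexOrder

/-- The Cayley octonions, as a real vector space of dimension 8. The first component is the
coefficient of `e₀ = 1`; the second one gives the coefficients of `e₁, …, e₇`, the indices
being read modulo 7 (so that `e₇` has index `0 : Fin 7`). -/
def Octonion : Type := ℝ × (Fin 7 → ℝ)

namespace Octonion

instance : AddCommGroup Octonion := inferInstanceAs (AddCommGroup (ℝ × (Fin 7 → ℝ)))

instance : Module ℝ Octonion := inferInstanceAs (Module ℝ (ℝ × (Fin 7 → ℝ)))

/-- The real part. -/
def re (x : Octonion) : ℝ := x.1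

/-- The imaginary coefficients. -/
def im (x : Octonion) : Fin 7 → ℝ := x.2

/-- A real number, as a multiple of `e₀`. -/
def ofReal (r : ℝ) : Octonion := (r, 0)

/-- The octonion product: the bilinear product with unit `e₀` for which `eᵢ² = -e₀`,
`eᵢ eⱼ = - eⱼ eᵢ` for distinct `i, j ≥ 1`, and
`eₖ₊₁ eₖ₊₅ = eₖ₊₂ eₖ₊₃ = eₖ₊₄ eₖ₊₆ = eₖ` with indices modulo 7
(for `k = 1` this reads `e₂ e₆ = e₃ e₄ = e₅ e₇ = e₁`). -/
instance : Mul Octonion where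
  mul x y :=
    (x.re * y.re - ∑ i, x.im i * y.im i,
      fun k => x.re * y.im k + x.im k * y.re
        + (x.im (k + 1) * y.im (k + 5) - x.im (k + 5) * y.im (k + 1))
        + (x.im (k + 2) * y.im (k + 3) - x.im (k + 3) * y.im (k + 2))
        + (x.im (k + 4) * y.im (k + 6) - x.im (k + 6) * y.im (k + 4)))

/-- The conjugation `x ↦ x̄`. -/
instance : Star Octonion where
  star x := (x.re, -x.im)

/-- The squared norm `|x|² = x x̄`. -/
def normSq (x : Octonion) : ℝ := x.re ^ 2 + ∑ i, x.im i ^ 2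

theorem ext_re_im {x y : Octonion} (h : x.re = y.re) (h' : ∀ i, x.im i = y.im i) : x = y :=
  Prod.ext h (funext h')

theorem star_add' (x y : Octonion) : star (x + y) = star x + star y :=
  Prod.ext rfl (neg_add x.im y.im)

theorem star_zero' : star (0 : Octonion) = 0 := Prod.ext rfl neg_zero

theorem star_smul' (r : ℝ) (x : Octonion) : star (r • x) = r • star x :=
  Prod.ext rfl (smul_neg r x.im).symm

theorem star_ofReal (r : ℝ) : star (ofReal r) = ofReal r := Prod.ext rfl neg_zero

theorem star_mul' (x y : Octonion) : star (x * y) = star y * star x := by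
  apply ext_re_im
  · change x.re * y.re - ∑ i, x.im i * y.im i = y.re * x.re - ∑ i, (-y.im i) * (-x.im i)
    simp only [neg_mul_neg, mul_comm]
  · intro k
    change -(x.re * y.im k + x.im k * y.re
        + (x.im (k + 1) * y.im (k + 5) - x.im (k + 5) * y.im (k + 1))
        + (x.im (k + 2) * y.im (k + 3) - x.im (k + 3) * y.im (k + 2))
        + (x.im (k + 4) * y.im (k + 6) - x.im (k + 6) * y.im (k + 4)))
      = y.re * -x.im k + -y.im k * x.re
        + (-y.im (k + 1) * -x.im (k + 5) - -y.im (k + 5) * -x.im (k + 1))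
        + (-y.im (k + 2) * -x.im (k + 3) - -y.im (k + 3) * -x.im (k + 2))
        + (-y.im (k + 4) * -x.im (k + 6) - -y.im (k + 6) * -x.im (k + 4))
    ring

theorem star_sum' {ι : Type*} (s : Finset ι) (f : ι → Octonion) :
    star (∑ i ∈ s, f i) = ∑ i ∈ s, star (f i) :=
  map_sum (⟨⟨star, star_zero'⟩, star_add'⟩ : Octonion →+ Octonion) f s

end Octonion

/-! ### The exceptional Jordan algebra -/

/-- The exceptional Jordan algebra: the `3 × 3` octonionic matrices with `M* = M`. -/
def jordanSubmodule : Submodule ℝ (Matrix (Fin 3) (Fin 3) Octonion) where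
  carrier := {M | M.conjTranspose = M}
  add_mem' := by
    intro M N hM hN
    ext1 i j
    have h₁ := congrFun (congrFun hM i) j
    have h₂ := congrFun (congrFun hN i) j
    change star (M j i + N j i) = M i j + N i j
    change star (M j i) = M i j at h₁
    change star (N j i) = N i j at h₂
    rw [Octonion.star_add', h₁, h₂]
  zero_mem' := by
    ext1 i j
    exact Octonion.star_zero'
  smul_mem' := by
    intro r M hM
    ext1 i j
    have h₁ := congrFun (congrFun hM i) j
    change star (r • M j i) = r • M i j
    change star (M j i) = M i j at h₁
    rw [Octonion.star_smul', h₁]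

/-- The exceptional Jordan algebra, as a type. -/
abbrev J : Type := jordanSubmodule

/-- The Jordan multiplication `M ⋆ N = (MN + NM) / 2`. -/
def jmul (M N : J) : J :=
  ⟨(1 / 2 : ℝ) • (M.1 * N.1 + N.1 * M.1), by
    have hM : ∀ i j, star (M.1 j i) = M.1 i j := fun i j => congrFun (congrFun M.2 i) j
    have hN : ∀ i j, star (N.1 j i) = N.1 i j := fun i j => congrFun (congrFun N.2 i) j
    refine jordanSubmodule.smul_mem _ ?_
    ext1 i j
    change star ((M.1 * N.1) j i + (N.1 * M.1) j i) = (M.1 * N.1) i j + (N.1 * M.1) i j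
    simp only [Matrix.mul_apply, Octonion.star_add', Octonion.star_sum', Octonion.star_mul', hM, hN]
    exact add_comm _ _⟩

/-- The diagonal element of the Jordan algebra with real diagonal entries `d`. -/
def diag (d : Fin 3 → ℝ) : J :=
  ⟨Matrix.diagonal fun i => Octonion.ofReal (d i), by
    ext1 i j
    change star (Matrix.diagonal (fun i => Octonion.ofReal (d i)) j i) = _
    by_cases h : i = j
    · subst h
      simp only [Matrix.diagonal_apply_eq, Octonion.star_ofReal]
    · rw [Matrix.diagonal_apply_ne _ h, Matrix.diagonal_apply_ne _ (Ne.symm h),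
        Octonion.star_zero']⟩

/-- The identity matrix. -/
def one : J := diag fun _ => 1

/-- Freudenthal's determinant
`ξ₁ξ₂ξ₃ - (ξ₁|x₁|² + ξ₂|x₂|² + ξ₃|x₃|²) + 2 Re(x₁x₂x₃)` of the matrix with rows
`(ξ₁, x₃, x̄₂)`, `(x̄₃, ξ₂, x₁)`, `(x₂, x̄₁, ξ₃)`. -/
def det (M : J) : ℝ :=
  (M.1 0 0).re * (M.1 1 1).re * (M.1 2 2).re
    - ((M.1 0 0).re * (M.1 1 2).normSq + (M.1 1 1).re * (M.1 2 0).normSq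
      + (M.1 2 2).re * (M.1 0 1).normSq)
    + 2 * ((M.1 1 2 * M.1 2 0) * M.1 0 1).re

/-- The group `E₆₍₋₂₆₎` of the linear automorphisms of `J` that preserve the determinant. -/
def E6 : Subgroup (J ≃ₗ[ℝ] J) where
  carrier := {g | ∀ M, det (g M) = det M}
  one_mem' := fun _ => rfl
  mul_mem' := fun {_ h} hg hh M => (hg (h M)).trans (hh M)
  inv_mem' := fun {g} hg M => by
    have h := hg (g.symm M)
    rw [LinearEquiv.apply_symm_apply] at h
    exact h.symm

/-- The maximal compact subgroup `F₄₍₋₅₂₎`: the stabilizer of the identity matrix in `E6`. -/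
def F4 : Subgroup (J ≃ₗ[ℝ] J) where
  carrier := {g | g ∈ E6 ∧ g one = one}
  one_mem' := ⟨E6.one_mem, rfl⟩
  mul_mem' := fun {g _} hg hh => ⟨E6.mul_mem hg.1 hh.1, (congrArg g hh.2).trans hg.2⟩
  inv_mem' := fun {g} hg => ⟨E6.inv_mem hg.1, g.symm_apply_eq.mpr hg.2.symm⟩

/-- An element of `J` is positive if diagonalizing it by an element of `F4` yields positive
diagonal entries. -/
def IsPositive (M : J) : Prop :=
  ∃ k ∈ F4, ∃ d : Fin 3 → ℝ, (∀ i, 0 < d i) ∧ k M = diag d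

/-! ### The symmetric space `X_O = E₆₍₋₂₆₎ / F₄₍₋₅₂₎` -/

/-- The model of `X_O`: positive elements of `J` of determinant one. -/
def XO : Type := {M : J // det M = 1 ∧ IsPositive M}

/-- `N = g ∘ M` for the action `g ∘ M = √(g(M²))` of `E6` on `X_O`: `N` is the positive element
of determinant one with `N ⋆ N = g (M ⋆ M)`. -/
def IsActO (g : E6) (M : J) (N : XO) : Prop :=
  jmul N.1 N.1 = g.1 (jmul M M)

/-- The largest of three real numbers. -/
def max3 (d : Fin 3 → ℝ) : ℝ := max (max (d 0) (d 1)) (d 2)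

/-- The distance on `X_O`: `d(M, N) = log ‖D‖ + log ‖D⁻¹‖`, where `D` is a diagonal element of
`X_O` such that `M = g ∘ I` and `N = g ∘ D` for some `g` in `E6`, and `‖D‖` is the largest diagonal
entry. Such `D` exists and is unique up to a permutation of its diagonal entries, so that the
set below has exactly one element. -/
def distO (M N : XO) : ℝ :=
  sInf {r | ∃ (g : E6) (d : Fin 3 → ℝ), (∀ i, 0 < d i) ∧ ∏ i, d i = 1 ∧
    IsActO g one M ∧ IsActO g (diag d) N ∧
    r = Real.log (max3 d) + Real.log (max3 fun i => (d i)⁻¹)}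

/-- The (affinely parametrized, complete) geodesics of the symmetric space `X_O`: the
curves `t ↦ g ∘ exp (t H)` with `g` in `E6` and `H` real diagonal of trace zero. -/
def IsGeodesicLineO (γ : ℝ → XO) : Prop :=
  ∃ (g : E6) (a : Fin 3 → ℝ), ∑ i, a i = 0 ∧
    ∀ t, IsActO g (diag fun i => Real.exp (t * a i)) (γ t)

/-- `γ`, restricted to `[0, L]`, is a geodesic from `M` to `N` for the distance of `X_O`. -/
def IsGeodesicSegmentO (γ : ℝ → XO) (L : ℝ) (M N : XO) : Prop :=
  0 ≤ L ∧ γ 0 = M ∧ γ L = N ∧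
    ∀ s ∈ Set.Icc 0 L, ∀ t ∈ Set.Icc 0 L, distO (γ s) (γ t) = |s - t|

/-! ### The symmetric space `X_C = SL₃(C) / SU₃` -/

/-- The model of `X_C`: positive definite Hermitian matrices of determinant one. -/
def XC : Type := {M : Matrix (Fin 3) (Fin 3) ℂ // M.PosDef ∧ M.det = 1}

/-- `N = g(M)` for the action `g(M) = (g M² g*)^{1/2}` of `SL₃(C)` on `X_C`. -/
def IsActC (g : Matrix.SpecialLinearGroup (Fin 3) ℂ) (M : Matrix (Fin 3) (Fin 3) ℂ) (N : XC) :
    Prop :=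
  N.1 * N.1 = g.1 * (M * M) * g.1.conjTranspose

/-- The operator norm of a complex `3 × 3` matrix acting on the Hermitian space `ℂ³`. -/
def opNorm (M : Matrix (Fin 3) (Fin 3) ℂ) : ℝ := ‖Matrix.toEuclideanCLM (n := Fin 3) (𝕜 := ℂ) M‖

/-- The distance `d(x, y) = log ‖x⁻¹ y‖ + log ‖y⁻¹ x‖` on `X_C`. -/
def distC (x y : XC) : ℝ :=
  Real.log (opNorm (x.1⁻¹ * y.1)) + Real.log (opNorm (y.1⁻¹ * x.1))

/-- The (affinely parametrized, complete) geodesics of the symmetric space `X_C`. -/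
def IsGeodesicLineC (γ : ℝ → XC) : Prop :=
  ∃ (g : Matrix.SpecialLinearGroup (Fin 3) ℂ) (a : Fin 3 → ℝ), ∑ i, a i = 0 ∧
    ∀ t, IsActC g (Matrix.diagonal fun i => (Real.exp (t * a i) : ℂ)) (γ t)

/-! ### Totally geodesic embeddings -/

/-- Totally geodesic embeddings of `X_C` in `X_O`: isometric maps which send the geodesics of the
symmetric space `X_C` to geodesics of the symmetric space `X_O`, and whose image contains
every geodesic segment (for the distance of `X_O`) joining two of its points. -/
structure IsTotallyGeodesicEmbedding (φ : XC → XO) : Prop where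
  isometric : ∀ x y, distO (φ x) (φ y) = distC x y
  map_geodesicLine : ∀ γ : ℝ → XC, IsGeodesicLineC γ → IsGeodesicLineO (φ ∘ γ)
  geodesicSegment_subset : ∀ x y (γ : ℝ → XO) (L : ℝ), IsGeodesicSegmentO γ L (φ x) (φ y) →
    ∀ t ∈ Set.Icc 0 L, γ t ∈ Set.range φ

end FreudenthalE6

end

noncomputable section

namespace FreudenthalE6

/-! ### Octonion arithmetic: alternativity, Moufang identity, complex lines -/

namespace Octonion

/-! Since the actions are defined through squares, everything is read on `M ⋆ M`: squaring
identifies `X_O` with the orbit of `I` under `E6`, on which `E6` acts linearly. Three points are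
then put in a common complex form. Move the first to `I`; move the second to a diagonal matrix by an
element of `F4`, which keeps `I`; move the third by an element of `spinGroup`, which keeps all
diagonal matrices, so that its off-diagonal entries lie in one line `ℝ + ℝe`
(`exists_spin_complex`). This works because two of the three off-diagonal entries can be made real,
and a single octonion always lies in a complex line.

Hermitian complex matrices embed in `J` through `e`, and on their image `A ↦ g A gᴴ` is induced by
an element of `E6` for each `g` in `SL₃(ℂ)`; it suffices to check generators
(`actsByE6_of_specialLinearGroup`). Hence the complex matrices give a map `X_C → X_O` compatible
with the actions. It preserves distances and geodesic lines because in both spaces these are defined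
by diagonal matrices moved by the group.

The distance is only a Finsler one, with many geodesic segments between two points, so convexity of
the image needs an argument. If `W` is the square of a point on a segment from `I` to the diagonal
`D`, equality in the triangle inequality forces two diagonal entries of `W` to be extremal
eigenvalues, and then `W` is diagonal (`eq_diag_of_additive`), hence complex.

The supporting facts are that `F4` acts by Jordan automorphisms, that `E6` preserves the cone of
positive semidefinite elements, and that a positive square root is unique. -/

@[simp] theorem re_add (x y : Octonion) : (x + y).re = x.re + y.re := rfl
@[simp] theorem im_add (x y : Octonion) (k : Fin 7) : (x + y).im k = x.im k + y.im k := rfl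
@[simp] theorem re_sub (x y : Octonion) : (x - y).re = x.re - y.re := rfl
@[simp] theorem im_sub (x y : Octonion) (k : Fin 7) : (x - y).im k = x.im k - y.im k := rfl
@[simp] theorem re_neg (x : Octonion) : (-x).re = -x.re := rfl
@[simp] theorem im_neg (x : Octonion) (k : Fin 7) : (-x).im k = -x.im k := rfl
@[simp] theorem re_zero : (0 : Octonion).re = 0 := rfl
@[simp] theorem im_zero (k : Fin 7) : (0 : Octonion).im k = 0 := rfl
@[simp] theorem re_smul (r : ℝ) (x : Octonion) : (r • x).re = r * x.re := rfl
@[simp] theorem im_smul (r : ℝ) (x : Octonion) (k : Fin 7) : (r • x).im k = r * x.im k := rfl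
@[simp] theorem re_star (x : Octonion) : (star x).re = x.re := rfl
@[simp] theorem im_star (x : Octonion) (k : Fin 7) : (star x).im k = -x.im k := rfl
@[simp] theorem re_ofReal (r : ℝ) : (ofReal r).re = r := rfl
@[simp] theorem im_ofReal (r : ℝ) (k : Fin 7) : (ofReal r).im k = 0 := rfl

theorem re_mul (x y : Octonion) : (x * y).re = x.re * y.re - ∑ i, x.im i * y.im i := rfl

theorem im_mul (x y : Octonion) (k : Fin 7) : (x * y).im k =
    x.re * y.im k + x.im k * y.re
        + (x.im (k + 1) * y.im (k + 5) - x.im (k + 5) * y.im (k + 1))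
        + (x.im (k + 2) * y.im (k + 3) - x.im (k + 3) * y.im (k + 2))
        + (x.im (k + 4) * y.im (k + 6) - x.im (k + 6) * y.im (k + 4)) := rfl

theorem forall_fin_seven {p : Fin 7 → Prop} :
    (∀ i, p i) ↔ p 0 ∧ p 1 ∧ p 2 ∧ p 3 ∧ p 4 ∧ p 5 ∧ p 6 := by
  refine ⟨fun h => ⟨h _, h _, h _, h _, h _, h _, h _⟩, ?_⟩
  rintro ⟨h0, h1, h2, h3, h4, h5, h6⟩ i
  fin_cases i <;> assumption

instance : NonUnitalNonAssocRing Octonion :=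
  { (inferInstance : AddCommGroup Octonion), (inferInstance : Mul Octonion) with
    left_distrib := fun x y z => by
      apply ext_re_im
      · simp only [re_mul, re_add, im_add, mul_add, Finset.sum_add_distrib]; ring
      · intro k; simp only [im_mul, re_add, im_add]; ring
    right_distrib := fun x y z => by
      apply ext_re_im
      · simp only [re_mul, re_add, im_add, add_mul, Finset.sum_add_distrib]; ring
      · intro k; simp only [im_mul, re_add, im_add]; ring
    zero_mul := fun x => by
      apply ext_re_im
      · simp [re_mul]
      · intro k; simp [im_mul]
    mul_zero := fun x => by
      apply ext_re_im
      · simp [re_mul]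
      · intro k; simp [im_mul] }

instance : IsScalarTower ℝ Octonion Octonion := ⟨fun r x y => by
  apply ext_re_im
  · simp only [smul_eq_mul, re_mul, re_smul, im_smul, mul_sub, Finset.mul_sum, mul_assoc]
  · intro k; simp only [smul_eq_mul, im_mul, re_smul, im_smul]; ring⟩

instance : SMulCommClass ℝ Octonion Octonion := ⟨fun r x y => by
  apply ext_re_im
  · simp only [smul_eq_mul, re_mul, re_smul, im_smul, mul_sub, Finset.mul_sum, mul_left_comm]
  · intro k; simp only [smul_eq_mul, im_mul, re_smul, im_smul]; ring⟩

theorem star_star' (x : Octonion) : star (star x) = x :=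
  ext_re_im rfl fun i => by simp

theorem star_neg' (x : Octonion) : star (-x) = -star x :=
  ext_re_im rfl fun i => by simp

theorem re_mul_comm (x y : Octonion) : (x * y).re = (y * x).re := by
  simp only [re_mul, mul_comm]

/-- The Euclidean inner product of two octonions. -/
def ip (x y : Octonion) : ℝ := x.re * y.re + ∑ i, x.im i * y.im i

/-- The trilinear form `Re (xyz)`. -/
def tri (x y z : Octonion) : ℝ := ((x * y) * z).re

theorem ip_comm (x y : Octonion) : ip x y = ip y x := by
  simp only [ip, mul_comm]

theorem ip_add_left (x y z : Octonion) : ip (x + y) z = ip x z + ip y z := by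
  simp only [ip, re_add, im_add, add_mul, Finset.sum_add_distrib]; ring

theorem ip_add_right (x y z : Octonion) : ip x (y + z) = ip x y + ip x z := by
  rw [ip_comm, ip_add_left, ip_comm y, ip_comm z]

theorem ip_smul_left (r : ℝ) (x y : Octonion) : ip (r • x) y = r * ip x y := by
  simp only [ip, re_smul, im_smul, mul_add, Finset.mul_sum, mul_assoc]

theorem ip_smul_right (r : ℝ) (x y : Octonion) : ip x (r • y) = r * ip x y := by
  rw [ip_comm, ip_smul_left, ip_comm]

theorem ip_zero_left (x : Octonion) : ip 0 x = 0 := by simp [ip]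

theorem ip_zero_right (x : Octonion) : ip x 0 = 0 := by simp [ip]

theorem ip_star_star (x y : Octonion) : ip (star x) (star y) = ip x y := by
  simp [ip]

theorem ip_self (x : Octonion) : ip x x = x.normSq := by
  simp only [ip, normSq, sq]

theorem normSq_nonneg (x : Octonion) : 0 ≤ x.normSq := by
  unfold normSq; positivity

theorem normSq_eq_zero {x : Octonion} (h : x.normSq = 0) : x = 0 := by
  unfold normSq at h
  have h1 : 0 ≤ ∑ i, x.im i ^ 2 := by positivity
  have h2 := sq_nonneg x.re
  have h3 : ∑ i, x.im i ^ 2 = 0 := by linarith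
  rw [Finset.sum_eq_zero_iff_of_nonneg fun i _ => sq_nonneg _] at h3
  exact ext_re_im (pow_eq_zero_iff two_ne_zero |>.mp (by linarith)) fun i =>
    pow_eq_zero_iff two_ne_zero |>.mp (h3 i (Finset.mem_univ i))

theorem normSq_add (x y : Octonion) :
    (x + y).normSq = x.normSq + 2 * ip x y + y.normSq := by
  rw [← ip_self, ip_add_left, ip_add_right, ip_add_right, ip_self, ip_self,
    ip_comm y x]
  ring

theorem normSq_smul (r : ℝ) (x : Octonion) : (r • x).normSq = r ^ 2 * x.normSq := by
  rw [← ip_self, ip_smul_left, ip_smul_right, ip_self]; ring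

theorem normSq_star (x : Octonion) : (star x).normSq = x.normSq := by
  rw [← ip_self, ip_star_star, ip_self]

theorem normSq_neg (x : Octonion) : (-x).normSq = x.normSq := by
  simp [normSq]

theorem re_star_mul (x y : Octonion) : (star x * y).re = ip x y := by
  simp [re_mul, ip]

theorem re_mul_star (x y : Octonion) : (x * star y).re = ip x y := by
  simp [re_mul, ip]

theorem re_mul_assoc (x y z : Octonion) : ((x * y) * z).re = (x * (y * z)).re := by
  simp only [re_mul, im_mul, Fin.sum_univ_seven, Fin.isValue, Fin.reduceAdd, zero_add]
  ring

/-- Alternativity, checked in coordinates. Conjugation turns it into the other cancellation laws,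
and with `re_mul_assoc` it gives the multiplicativity of the norm. -/
theorem star_mul_mul_cancel (x y : Octonion) : star x * (x * y) = x.normSq • y := by
  apply ext_re_im
  · simp only [re_mul, im_mul, re_star, im_star, re_smul, normSq, Fin.sum_univ_seven, Fin.isValue,
      Fin.reduceAdd, zero_add]
    ring
  · rw [forall_fin_seven]
    simp only [re_mul, im_mul, re_star, im_star, im_smul, normSq, Fin.sum_univ_seven, Fin.isValue,
      Fin.reduceAdd, zero_add]
    refine ⟨?_, ?_, ?_, ?_, ?_, ?_, ?_⟩ <;> ring

theorem moufang (u x y : Octonion) : (u * x) * (y * u) = u * ((x * y) * u) := by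
  apply ext_re_im
  · simp only [re_mul, im_mul, Fin.sum_univ_seven, Fin.isValue,
      Fin.reduceAdd, zero_add]
    ring
  · rw [forall_fin_seven]
    simp only [re_mul, im_mul, Fin.sum_univ_seven, Fin.isValue,
      Fin.reduceAdd, zero_add]
    refine ⟨?_, ?_, ?_, ?_, ?_, ?_, ?_⟩ <;> ring

theorem mul_star_mul_cancel (x y : Octonion) : x * (star x * y) = x.normSq • y := by
  have h := star_mul_mul_cancel (star x) y
  rwa [star_star', normSq_star] at h

theorem mul_mul_star_cancel (y x : Octonion) : (y * x) * star x = x.normSq • y := by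
  have h := congrArg star (mul_star_mul_cancel x (star y))
  simpa only [star_mul', star_star', star_smul'] using h

theorem mul_star_mul_cancel_right (y x : Octonion) : (y * star x) * x = x.normSq • y := by
  have h := mul_mul_star_cancel y (star x)
  rwa [star_star', normSq_star] at h

theorem normSq_mul (x y : Octonion) : (x * y).normSq = x.normSq * y.normSq := by
  rw [← ip_self, ← re_star_mul, star_mul', re_mul_assoc, star_mul_mul_cancel, mul_smul_comm,
    re_smul, re_star_mul, ip_self]

theorem tri_rotate (x y z : Octonion) : tri y z x = tri x y z := by
  rw [tri, re_mul_comm, tri, re_mul_assoc]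

theorem tri_add_left (x x' y z : Octonion) : tri (x + x') y z = tri x y z + tri x' y z := by
  simp only [tri, add_mul, re_add]

theorem tri_add_mid (x y y' z : Octonion) : tri x (y + y') z = tri x y z + tri x y' z := by
  simp only [tri, add_mul, mul_add, re_add]

theorem tri_add_right (x y z z' : Octonion) : tri x y (z + z') = tri x y z + tri x y z' := by
  simp only [tri, mul_add, re_add]

theorem tri_smul_left (r : ℝ) (x y z : Octonion) : tri (r • x) y z = r * tri x y z := by
  simp only [tri, smul_mul_assoc, re_smul]

theorem tri_smul_mid (r : ℝ) (x y z : Octonion) : tri x (r • y) z = r * tri x y z := by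
  simp only [tri, smul_mul_assoc, mul_smul_comm, re_smul]

theorem tri_smul_right (r : ℝ) (x y z : Octonion) : tri x y (r • z) = r * tri x y z := by
  simp only [tri, mul_smul_comm, re_smul]

theorem tri_star (x y z : Octonion) : tri (star x) (star y) (star z) = tri z y x := by
  rw [tri, ← re_star, star_mul', star_mul', star_star', star_star', star_star', tri, re_mul_assoc]

theorem ip_star_mul (x y z : Octonion) : ip (star (x * y)) z = tri x y z := by
  rw [← re_star_mul, star_star', tri]

theorem ip_star_mul_right (x y z : Octonion) : ip x (star (y * z)) = tri x y z := by
  rw [ip_comm, ip_star_mul, tri_rotate]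

/-- By Moufang `(ux)(yu) = u((xy)u)`; as real parts are cyclic and associative, each `u` can be
brought next to a `ū` and cancelled. For unit `u` this is the invariance that puts `spin` in `E6`.
-/
theorem tri_spin (u x y z : Octonion) :
    tri (u * x) (y * u) ((star u * z) * star u) = u.normSq ^ 2 * tri x y z := by
  rw [tri, moufang, re_mul_assoc, re_mul_comm, re_mul_assoc, mul_star_mul_cancel_right,
    mul_smul_comm, re_smul, re_mul_assoc, mul_star_mul_cancel, mul_smul_comm, re_smul, tri]
  ring

theorem ofReal_mul (r : ℝ) (x : Octonion) : ofReal r * x = r • x := by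
  apply ext_re_im
  · simp [re_mul]
  · intro k; simp [im_mul]

theorem mul_ofReal (x : Octonion) (r : ℝ) : x * ofReal r = r • x := by
  apply ext_re_im
  · simp [re_mul, mul_comm]
  · intro k; simp [im_mul, mul_comm]

theorem ofReal_add (a b : ℝ) : ofReal (a + b) = ofReal a + ofReal b :=
  ext_re_im rfl fun i => by simp

theorem smul_ofReal (a b : ℝ) : a • ofReal b = ofReal (a * b) :=
  ext_re_im rfl fun i => by simp

theorem mul_star_self (x : Octonion) : x * star x = ofReal x.normSq := by
  have h := mul_star_mul_cancel x (ofReal 1)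
  rwa [mul_ofReal, one_smul, smul_ofReal, mul_one] at h

theorem star_mul_self' (x : Octonion) : star x * x = ofReal x.normSq := by
  have h := mul_star_self (star x)
  rwa [star_star', normSq_star] at h

theorem eq_ofReal_of_star {x : Octonion} (h : star x = x) : x = ofReal x.re := by
  refine ext_re_im rfl fun i => ?_
  have := congrArg (fun y => im y i) h
  simp only [im_star] at this
  simp; linarith

/-- An imaginary unit of the octonions. -/
structure IsImaginaryUnit (e : Octonion) : Prop where
  re_eq : e.re = 0
  normSq_eq : e.normSq = 1

/-- The embedding of `ℂ` in the octonions sending `i` to `e`. -/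
def ofComplex (e : Octonion) (z : ℂ) : Octonion := ofReal z.re + z.im • e

theorem IsImaginaryUnit.star_eq {e : Octonion} (he : e.IsImaginaryUnit) : star e = -e :=
  ext_re_im (by simp [he.re_eq]) fun i => by simp

theorem IsImaginaryUnit.mul_self {e : Octonion} (he : e.IsImaginaryUnit) :
    e * e = ofReal (-1) := by
  have h := mul_star_self e
  rw [he.star_eq, he.normSq_eq, mul_neg, neg_eq_iff_eq_neg] at h
  rw [h]
  exact ext_re_im rfl fun i => by simp

theorem ofComplex_add (e : Octonion) (z w : ℂ) :
    ofComplex e (z + w) = ofComplex e z + ofComplex e w := by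
  simp only [ofComplex, Complex.add_re, Complex.add_im, ofReal_add, add_smul]; abel

theorem ofComplex_neg (e : Octonion) (z : ℂ) : ofComplex e (-z) = -ofComplex e z :=
  ext_re_im (by simp [ofComplex]; ring) fun i => by simp [ofComplex]

theorem ofComplex_ofReal (e : Octonion) (r : ℝ) : ofComplex e r = ofReal r := by
  simp [ofComplex]

theorem ofComplex_real_mul (e : Octonion) (r : ℝ) (z : ℂ) :
    ofComplex e (r * z) = r • ofComplex e z := by
  simp [ofComplex, smul_add, smul_ofReal, mul_smul]

theorem ofComplex_mul {e : Octonion} (he : e.IsImaginaryUnit) (z w : ℂ) :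
    ofComplex e (z * w) = ofComplex e z * ofComplex e w := by
  simp only [ofComplex, add_mul, mul_add, ofReal_mul, mul_ofReal, smul_mul_assoc, mul_smul_comm,
    he.mul_self, smul_ofReal, Complex.mul_re, Complex.mul_im, add_smul]
  apply ext_re_im
  · simp; ring
  · intro i; simp; ring

theorem star_ofComplex {e : Octonion} (he : e.IsImaginaryUnit) (z : ℂ) :
    star (ofComplex e z) = ofComplex e (star z) := by
  simp [ofComplex, star_add', star_ofReal, star_smul', he.star_eq]

theorem normSq_ofComplex {e : Octonion} (he : e.IsImaginaryUnit) (z : ℂ) :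
    (ofComplex e z).normSq = Complex.normSq z := by
  have h : (ofComplex e z * star (ofComplex e z)).re = (ofComplex e (z * star z)).re := by
    rw [star_ofComplex he, ofComplex_mul he]
  rw [mul_star_self, show z * star z = ((Complex.normSq z : ℝ) : ℂ) from Complex.mul_conj z,
    ofComplex_ofReal] at h
  exact h

theorem re_ofComplex {e : Octonion} (he : e.IsImaginaryUnit) (z : ℂ) :
    (ofComplex e z).re = z.re := by
  simp [ofComplex, he.re_eq]

theorem ip_ofComplex {e : Octonion} (he : e.IsImaginaryUnit) (z w : ℂ) :
    ip (ofComplex e z) (ofComplex e w) = (z * star w).re := by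
  rw [← re_mul_star, star_ofComplex he, ← ofComplex_mul he, re_ofComplex he]

theorem exists_ofComplex (x : Octonion) :
    ∃ e : Octonion, e.IsImaginaryUnit ∧ ∃ z : ℂ, x = ofComplex e z := by
  obtain ⟨y, hx, hy0⟩ : ∃ y : Octonion, x = ofReal x.re + y ∧ y.re = 0 :=
    ⟨x - ofReal x.re, by abel, by simp⟩
  rcases eq_or_ne y 0 with h | h
  · obtain ⟨e, he⟩ : ∃ e : Octonion, e.IsImaginaryUnit := by
      -- A real octonion lies in every complex line; the unit chosen is `e₇`, of index `0`.
      refine ⟨((0, Pi.single 0 1) : ℝ × (Fin 7 → ℝ)), ⟨rfl, ?_⟩⟩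
      simp [normSq, re, im, Fin.sum_univ_seven]
    · refine ⟨e, he, (x.re : ℂ), ?_⟩
      rw [ofComplex_ofReal]; simpa [h] using hx
  · have hpos : 0 < y.normSq :=
      lt_of_le_of_ne y.normSq_nonneg fun h0 => h (normSq_eq_zero h0.symm)
    have hs : √y.normSq ≠ 0 := (Real.sqrt_pos.mpr hpos).ne'
    refine ⟨(√y.normSq)⁻¹ • y, ⟨by simp [hy0], ?_⟩, ⟨x.re, √y.normSq⟩, ?_⟩
    · rw [normSq_smul, inv_pow, Real.sq_sqrt hpos.le, inv_mul_cancel₀ hpos.ne']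
    · simp only [ofComplex, smul_smul, mul_inv_cancel₀ hs, one_smul]
      exact hx

end Octonion

end FreudenthalE6

end

noncomputable section

namespace FreudenthalE6

open Octonion

/-! ### Coordinates on the exceptional Jordan algebra -/

/-- The diagonal entries. -/
def dg (M : J) (i : Fin 3) : ℝ := (M.1 i i).re

/-- The off-diagonal entries `x₁, x₂, x₃`. -/
def off (M : J) (i : Fin 3) : Octonion := M.1 (i + 1) (i + 2)

theorem star_apply (M : J) (i j : Fin 3) : star (M.1 j i) = M.1 i j :=
  congrFun (congrFun M.2 i) j

theorem apply_diag (M : J) (i : Fin 3) : M.1 i i = ofReal (dg M i) :=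
  eq_ofReal_of_star (star_apply M i i)

theorem coe_eq (M : J) : M.1 = !![ofReal (dg M 0), off M 2, star (off M 1);
    star (off M 2), ofReal (dg M 1), off M 0; off M 1, star (off M 0), ofReal (dg M 2)] := by
  ext1 i j
  fin_cases i <;> fin_cases j <;>
    first | exact apply_diag M _ | exact (star_apply M _ _).symm | rfl

theorem J_ext {M N : J} (h : ∀ i, dg M i = dg N i) (h' : ∀ i, off M i = off N i) : M = N := by
  apply Subtype.ext
  rw [coe_eq M, coe_eq N]
  simp only [h, h']

/-- The element of the Jordan algebra with given coordinates. -/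
def mk (a : Fin 3 → ℝ) (x : Fin 3 → Octonion) : J :=
  ⟨!![ofReal (a 0), x 2, star (x 1); star (x 2), ofReal (a 1), x 0;
    x 1, star (x 0), ofReal (a 2)], by
    change Matrix.conjTranspose _ = _
    ext1 i j
    fin_cases i <;> fin_cases j <;> first | exact star_ofReal _ | exact star_star' _ | rfl⟩

@[simp] theorem dg_mk (a : Fin 3 → ℝ) (x : Fin 3 → Octonion) : dg (mk a x) = a := by
  funext i; fin_cases i <;> rfl

@[simp] theorem off_mk (a : Fin 3 → ℝ) (x : Fin 3 → Octonion) : off (mk a x) = x := by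
  funext i; fin_cases i <;> rfl

@[simp] theorem dg_add (M N : J) (i : Fin 3) : dg (M + N) i = dg M i + dg N i := rfl
@[simp] theorem off_add (M N : J) (i : Fin 3) : off (M + N) i = off M i + off N i := rfl
@[simp] theorem dg_sub (M N : J) (i : Fin 3) : dg (M - N) i = dg M i - dg N i := rfl
@[simp] theorem off_sub (M N : J) (i : Fin 3) : off (M - N) i = off M i - off N i := rfl
@[simp] theorem dg_smul (r : ℝ) (M : J) (i : Fin 3) : dg (r • M) i = r * dg M i := rfl
@[simp] theorem off_smul (r : ℝ) (M : J) (i : Fin 3) : off (r • M) i = r • off M i := rfl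
@[simp] theorem dg_zero (i : Fin 3) : dg 0 i = 0 := rfl
@[simp] theorem off_zero (i : Fin 3) : off 0 i = 0 := rfl

@[simp] theorem dg_diag (d : Fin 3 → ℝ) (i : Fin 3) : dg (diag d) i = d i := by
  simp [dg, diag]

@[simp] theorem off_diag (d : Fin 3 → ℝ) (i : Fin 3) : off (diag d) i = 0 :=
  Matrix.diagonal_apply_ne _ (by fin_cases i <;> decide)

@[simp] theorem dg_one (i : Fin 3) : dg one i = 1 := dg_diag _ _
@[simp] theorem off_one (i : Fin 3) : off one i = 0 := off_diag _ _

theorem det_eq (M : J) : det M = dg M 0 * dg M 1 * dg M 2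
    - (dg M 0 * (off M 0).normSq + dg M 1 * (off M 1).normSq + dg M 2 * (off M 2).normSq)
    + 2 * tri (off M 0) (off M 1) (off M 2) := rfl

theorem dg_jmul (M N : J) (i : Fin 3) : dg (jmul M N) i = dg M i * dg N i
    + ip (off M (i + 1)) (off N (i + 1)) + ip (off M (i + 2)) (off N (i + 2)) := by
  change ((1 / 2 : ℝ) • (M.1 * N.1 + N.1 * M.1) i i).re = _
  rw [re_smul, Matrix.add_apply, Matrix.mul_apply, Matrix.mul_apply, coe_eq M, coe_eq N]
  fin_cases i <;>
  · simp [Fin.sum_univ_three, re_mul_star, re_star_mul, ofReal_mul, ip_comm (off N _)]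
    ring

theorem off_jmul (M N : J) (i : Fin 3) : off (jmul M N) i = (1 / 2 : ℝ) •
    ((dg M (i + 1) + dg M (i + 2)) • off N i + (dg N (i + 1) + dg N (i + 2)) • off M i
      + star (off M (i + 1) * off N (i + 2) + off N (i + 1) * off M (i + 2))) := by
  change (1 / 2 : ℝ) • (M.1 * N.1 + N.1 * M.1) (i + 1) (i + 2) = _
  rw [Matrix.add_apply, Matrix.mul_apply, Matrix.mul_apply, coe_eq M, coe_eq N]
  congr 1
  fin_cases i <;>
  · simp [Fin.sum_univ_three, ofReal_mul, mul_ofReal, star_add', Octonion.star_mul', add_smul]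
    abel

theorem jmul_comm (M N : J) : jmul M N = jmul N M := by
  unfold jmul
  simp only [add_comm]

theorem jmul_add (M N P : J) : jmul M (N + P) = jmul M N + jmul M P :=
  Subtype.ext (by
    change (1 / 2 : ℝ) • (M.1 * (N.1 + P.1) + (N.1 + P.1) * M.1) =
      (1 / 2 : ℝ) • (M.1 * N.1 + N.1 * M.1) + (1 / 2 : ℝ) • (M.1 * P.1 + P.1 * M.1)
    rw [mul_add, add_mul, ← smul_add]; congr 1; abel)

theorem add_jmul (M N P : J) : jmul (M + N) P = jmul M P + jmul N P := by
  rw [jmul_comm, jmul_add, jmul_comm P, jmul_comm P]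

theorem jmul_diag_diag (d d' : Fin 3 → ℝ) : jmul (diag d) (diag d') = diag fun i => d i * d' i :=
  J_ext (fun i => by simp [dg_jmul, ip_zero_left]) fun i => by simp [off_jmul, star_zero']

/-- The trace. -/
def tr (M : J) : ℝ := dg M 0 + dg M 1 + dg M 2

theorem tr_add (M N : J) : tr (M + N) = tr M + tr N := by
  simp only [tr, dg_add]; ring

/-- The quadratic coefficient of the characteristic polynomial. -/
def quad (M : J) : ℝ := dg M 0 * dg M 1 + dg M 1 * dg M 2 + dg M 2 * dg M 0
  - ((off M 0).normSq + (off M 1).normSq + (off M 2).normSq)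

/-- The characteristic polynomial of `M`: a linear map preserving `det` and fixing `one` must
preserve all its coefficients. -/
theorem det_smul_one_sub (t : ℝ) (M : J) :
    det (t • one - M) = t ^ 3 - tr M * t ^ 2 + quad M * t - det M := by
  have h : ∀ i, off (t • one - M) i = (-1 : ℝ) • off M i := fun i => by simp
  simp only [det_eq, h, normSq_smul, tri_smul_left, tri_smul_mid, tri_smul_right, dg_sub, dg_smul,
    dg_one, tr, quad]
  ring

theorem tr_jmul (M N : J) : tr (jmul M N) = tr M * tr N - (quad (M + N) - quad M - quad N) := by
  simp only [tr, quad, dg_jmul, dg_add, off_add, normSq_add, Fin.isValue, Fin.reduceAdd, zero_add]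
  ring

/-- The part of `det (M + N)` linear in `N` is `tr (M^# ⋆ N)`, with adjoint `M^# = M ⋆ M - tr M • M
+ quad M • one`. Thus `tr`, `quad` and `det` determine the pairing of `M ⋆ M` with `N`. -/
theorem tr_jmul_jmul (M N : J) : tr (jmul (jmul M M) N) =
    (det (M + N) - det (M + (-1 : ℝ) • N)) / 2 - det N + tr M * tr (jmul M N)
      - quad M * tr N := by
  simp only [tr, quad, dg_jmul, off_jmul, det_eq, dg_add, off_add, dg_smul, off_smul, normSq_add,
    normSq_smul, tri_add_left, tri_add_mid, tri_add_right, tri_smul_left, tri_smul_mid,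
    tri_smul_right, ip_smul_left, ip_smul_right, ip_add_left,
    star_add', ip_star_mul, ip_self, Fin.isValue, Fin.reduceAdd, zero_add]
  rw [tri_rotate (off N 0) (off M 1) (off M 2), ← tri_rotate (off M 2) (off M 0) (off N 1)]
  ring

/-- The trace form is positive definite: `tr (Q ⋆ Q)` is a sum of squares, here for `Q = M - N`. -/
theorem eq_of_tr_jmul {M N : J} (h : ∀ P, tr (jmul M P) = tr (jmul N P)) : M = N := by
  have h1 := h (M - N)
  have h2 : tr (jmul (M - N) (M - N)) = 0 := by
    have h3 : tr (jmul (N + (M - N)) (M - N)) = tr (jmul N (M - N)) := by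
      rw [← h1, add_sub_cancel]
    rw [add_jmul, tr_add] at h3
    linarith
  simp only [tr, dg_jmul, ip_self, Fin.isValue, Fin.reduceAdd, zero_add] at h2
  set Q := M - N
  have p := fun i => (off Q i).normSq_nonneg
  have hd : ∀ i, dg Q i = 0 ∧ (off Q i).normSq = 0 := by
    have p0 := p 0
    have p1 := p 1
    have p2 := p 2
    intro i
    have hs : dg Q i * dg Q i = 0 ∧ (off Q i).normSq = 0 := by
      fin_cases i <;> simp only [Fin.zero_eta, Fin.mk_one, Fin.reduceFinMk] <;> constructor <;>
        nlinarith [mul_self_nonneg (dg Q 0), mul_self_nonneg (dg Q 1), mul_self_nonneg (dg Q 2)]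
    exact ⟨mul_self_eq_zero.mp hs.1, hs.2⟩
  have hQ : Q = 0 := J_ext (fun i => (hd i).1) fun i => normSq_eq_zero (hd i).2
  exact sub_eq_zero.mp hQ

/-! ### Elements of `F4` are automorphisms of the Jordan algebra -/

theorem tr_quad_of_mem_F4 {k : J ≃ₗ[ℝ] J} (hk : k ∈ F4) (M : J) :
    tr (k M) = tr M ∧ quad (k M) = quad M := by
  have h : ∀ t : ℝ, det (t • one - k M) = det (t • one - M) := fun t => by
    rw [← hk.1 (t • one - M), map_sub, map_smul, hk.2]
  simp only [det_smul_one_sub] at h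
  have h1 := h 1
  have h2 := h (-1)
  have h0 := h 0
  constructor <;> linarith

theorem tr_jmul_of_mem_F4 {k : J ≃ₗ[ℝ] J} (hk : k ∈ F4) (M N : J) :
    tr (jmul (k M) (k N)) = tr (jmul M N) := by
  simp only [tr_jmul, ← map_add, tr_quad_of_mem_F4 hk]

/-- The element `M ⋆ M` is determined by its trace pairings, which are expressed through invariants
of `F4`. Polarization then yields the full product. -/
theorem map_jmul_self_of_mem_F4 {k : J ≃ₗ[ℝ] J} (hk : k ∈ F4) (M : J) :
    k (jmul M M) = jmul (k M) (k M) := by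
  refine eq_of_tr_jmul fun P => ?_
  obtain ⟨N, rfl⟩ := k.surjective P
  rw [tr_jmul_of_mem_F4 hk, tr_jmul_jmul, tr_jmul_jmul, tr_jmul_of_mem_F4 hk]
  have hd : ∀ M, det (k M) = det M := hk.1
  simp only [← map_add, ← map_smul, hd, tr_quad_of_mem_F4 hk]

theorem map_jmul_of_mem_F4 {k : J ≃ₗ[ℝ] J} (hk : k ∈ F4) (M N : J) :
    k (jmul M N) = jmul (k M) (k N) := by
  have h := map_jmul_self_of_mem_F4 hk (M + N)
  simp only [map_add, jmul_add, add_jmul, map_jmul_self_of_mem_F4 hk, jmul_comm N M,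
    jmul_comm (k N) (k M)] at h
  have h2 : (2 : ℝ) • k (jmul M N) = (2 : ℝ) • jmul (k M) (k N) := by
    rw [two_smul, two_smul]
    have h3 := add_right_cancel (b := jmul (k N) (k N)) (c := jmul (k M) (k M) +
      (jmul (k M) (k N) + jmul (k M) (k N))) (a := jmul (k M) (k M) +
      (k (jmul M N) + k (jmul M N))) (by rw [← sub_eq_zero] at h ⊢; rw [← h]; abel)
    exact add_left_cancel h3
  exact smul_right_injective J two_ne_zero h2

end FreudenthalE6

end

noncomputable section

namespace FreudenthalE6

open Octonion

/-! ### Some elements of `E6` -/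

/-- The cyclic permutation of the coordinates. -/
def cyc : J ≃ₗ[ℝ] J where
  toFun M := mk (fun i => dg M (i + 1)) fun i => off M (i + 1)
  map_add' M N := J_ext (fun i => by simp) fun i => by simp
  map_smul' r M := J_ext (fun i => by simp) fun i => by simp
  invFun M := mk (fun i => dg M (i + 2)) fun i => off M (i + 2)
  left_inv M := J_ext (fun i => by simp [add_assoc]) fun i => by simp [add_assoc]
  right_inv M := J_ext (fun i => by simp [add_assoc]) fun i => by simp [add_assoc]

@[simp] theorem dg_cyc (M : J) (i : Fin 3) : dg (cyc M) i = dg M (i + 1) := by simp [cyc]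
@[simp] theorem off_cyc (M : J) (i : Fin 3) : off (cyc M) i = off M (i + 1) := by simp [cyc]

theorem cyc_mem_E6 : cyc ∈ E6 := fun M => by
  simp only [det_eq, dg_cyc, off_cyc, Fin.isValue, Fin.reduceAdd, zero_add]
  rw [tri_rotate]
  ring

/-- The exchange of the first two coordinates, with signs. -/
def swap : J ≃ₗ[ℝ] J where
  toFun M := mk ![dg M 1, dg M 0, dg M 2] ![-star (off M 1), star (off M 0), -star (off M 2)]
  map_add' M N := J_ext (fun i => by fin_cases i <;> simp) fun i => by
    fin_cases i <;> simp [star_add'] <;> abel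
  map_smul' r M := J_ext (fun i => by fin_cases i <;> simp) fun i => by
    fin_cases i <;> simp [star_smul']
  invFun M := mk ![dg M 1, dg M 0, dg M 2] ![star (off M 1), -star (off M 0), -star (off M 2)]
  left_inv M := J_ext (fun i => by fin_cases i <;> simp) fun i => by
    fin_cases i <;> simp [star_neg', star_star']
  right_inv M := J_ext (fun i => by fin_cases i <;> simp) fun i => by
    fin_cases i <;> simp [star_neg', star_star']

theorem dg_swap (M : J) : dg (swap M) = ![dg M 1, dg M 0, dg M 2] := by simp [swap]

theorem off_swap (M : J) :
    off (swap M) = ![-star (off M 1), star (off M 0), -star (off M 2)] := by simp [swap]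

/-- Conjugating the factors of `Re (xyz)` reverses their order, which the exchange of two indices
undoes; the two signs cancel. -/
theorem swap_mem_E6 : swap ∈ E6 := fun M => by
  have h : tri (-star (off M 1)) (star (off M 0)) (-star (off M 2)) =
      tri (off M 0) (off M 1) (off M 2) := by
    rw [← neg_one_smul ℝ (star (off M 1)), ← neg_one_smul ℝ (star (off M 2)), tri_smul_left,
      tri_smul_right, tri_star, ← tri_rotate]
    ring
  simp only [det_eq, dg_swap, off_swap, Matrix.cons_val, normSq_neg, normSq_star, h]
  ring

/-- The action of the elementary matrix with entry `a` in position `(0, 1)`. -/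
def transvec (a : Octonion) : J ≃ₗ[ℝ] J where
  toFun M := mk ![dg M 0 + 2 * ip a (off M 2) + a.normSq * dg M 1, dg M 1, dg M 2]
    ![off M 0, off M 1 + star (a * off M 0), off M 2 + dg M 1 • a]
  map_add' M N := J_ext (fun i => by fin_cases i <;> simp [ip_add_right]; ring) fun i => by
    fin_cases i <;> simp [star_add', mul_add, add_smul] <;> abel
  map_smul' r M := J_ext (fun i => by fin_cases i <;> simp [ip_smul_right]; ring) fun i => by
    fin_cases i <;> simp [star_smul', mul_smul_comm, mul_smul]
  invFun M := mk ![dg M 0 - 2 * ip a (off M 2) + a.normSq * dg M 1, dg M 1, dg M 2]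
    ![off M 0, off M 1 - star (a * off M 0), off M 2 - dg M 1 • a]
  left_inv M := J_ext (fun i => by
      fin_cases i <;> simp [ip_add_right, ip_smul_right, ip_self]; ring) fun i => by
    fin_cases i <;> simp
  right_inv M := J_ext (fun i => by
      fin_cases i <;> simp [sub_eq_add_neg, ← neg_smul, ip_add_right, ip_smul_right, ip_self]
      ring) fun i => by
    fin_cases i <;> simp

theorem dg_transvec (a : Octonion) (M : J) : dg (transvec a M) =
    ![dg M 0 + 2 * ip a (off M 2) + a.normSq * dg M 1, dg M 1, dg M 2] := by simp [transvec]

theorem off_transvec (a : Octonion) (M : J) : off (transvec a M) =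
    ![off M 0, off M 1 + star (a * off M 0), off M 2 + dg M 1 • a] := by simp [transvec]

theorem transvec_mem_E6 (a : Octonion) : transvec a ∈ E6 := fun M => by
  -- The term of the determinant quadratic in `x`: alternativity gives `x (x̄ ā) = |x|² ā`, so no
  -- associativity is needed.
  have h : ∀ x z, tri x (star (a * x)) z = x.normSq * ip a z := fun x z => by
    rw [tri, Octonion.star_mul', mul_star_mul_cancel, smul_mul_assoc, re_smul, re_star_mul]
  simp only [det_eq, dg_transvec, off_transvec, Matrix.cons_val, normSq_add, normSq_smul,
    normSq_star, normSq_mul, tri_add_mid, tri_add_right, tri_smul_right, h, ip_star_mul_right,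
    ip_smul_right, ip_self]
  rw [tri_rotate (off M 0) (off M 1) a, ip_comm a (off M 2)]
  ring

theorem mul_mul_self (u x : Octonion) : (u * x) * u = u * (x * u) := by
  have h := moufang u x (ofReal 1)
  rwa [ofReal_mul, one_smul, mul_ofReal, one_smul] at h

/-- The action of a unit octonion on the off-diagonal entries. -/
def spin (u : Octonion) (hu : u.normSq = 1) : J ≃ₗ[ℝ] J where
  toFun M := mk (dg M) ![u * off M 0, off M 1 * u, (star u * off M 2) * star u]
  map_add' M N := J_ext (fun i => by simp) fun i => by
    fin_cases i <;> simp [mul_add, add_mul]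
  map_smul' r M := J_ext (fun i => by simp) fun i => by
    fin_cases i <;> simp [mul_smul_comm, smul_mul_assoc]
  invFun M := mk (dg M) ![star u * off M 0, off M 1 * star u, (u * off M 2) * u]
  left_inv M := J_ext (fun i => by simp) fun i => by
    fin_cases i
    · simp [star_mul_mul_cancel, hu]
    · simp [mul_mul_star_cancel, hu]
    · simp [mul_mul_self (star u), mul_star_mul_cancel, mul_star_mul_cancel_right, hu]
  right_inv M := J_ext (fun i => by simp) fun i => by
    fin_cases i
    · simp [mul_star_mul_cancel, hu]
    · simp [mul_star_mul_cancel_right, hu]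
    · simp [mul_mul_self u, star_mul_mul_cancel, mul_mul_star_cancel, hu]

@[simp] theorem dg_spin (u : Octonion) (hu : u.normSq = 1) (M : J) : dg (spin u hu M) = dg M := by
  simp [spin]

@[simp] theorem off_spin (u : Octonion) (hu : u.normSq = 1) (M : J) : off (spin u hu M) =
    ![u * off M 0, off M 1 * u, (star u * off M 2) * star u] := by simp [spin]

theorem spin_mem_E6 (u : Octonion) (hu : u.normSq = 1) : spin u hu ∈ E6 := fun M => by
  simp only [det_eq, dg_spin, off_spin, Matrix.cons_val, tri_spin, normSq_mul, normSq_star, hu]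
  ring

theorem spin_diag (u : Octonion) (hu : u.normSq = 1) (d : Fin 3 → ℝ) :
    spin u hu (diag d) = diag d :=
  J_ext (fun i => by simp) fun i => by fin_cases i <;> simp

theorem dg_cyc_symm (M : J) (i : Fin 3) : dg (cyc.symm M) i = dg M (i + 2) := by
  obtain ⟨N, rfl⟩ := cyc.surjective M
  simp [add_assoc]

theorem off_cyc_symm (M : J) (i : Fin 3) : off (cyc.symm M) i = off M (i + 2) := by
  obtain ⟨N, rfl⟩ := cyc.surjective M
  simp [add_assoc]

/-! ### Reduction to complex matrices -/

/-- The linear maps in `E6` that fix all diagonal matrices. -/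
def spinGroup : Subgroup (J ≃ₗ[ℝ] J) where
  carrier := {g | g ∈ E6 ∧ ∀ d, g (diag d) = diag d}
  one_mem' := ⟨E6.one_mem, fun _ => rfl⟩
  mul_mem' := fun {g _} hg hh =>
    ⟨E6.mul_mem hg.1 hh.1, fun d => (congrArg g (hh.2 d)).trans (hg.2 d)⟩
  inv_mem' := fun {g} hg => ⟨E6.inv_mem hg.1, fun d => g.symm_apply_eq.mpr (hg.2 d).symm⟩

theorem spin_mem_spinGroup (u : Octonion) (hu : u.normSq = 1) : spin u hu ∈ spinGroup :=
  ⟨spin_mem_E6 u hu, spin_diag u hu⟩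

theorem exists_spin_off_zero (M : J) :
    ∃ g ∈ spinGroup, ∃ r : ℝ, off (g M) 0 = ofReal r := by
  rcases eq_or_ne (off M 0) 0 with h | h
  · exact ⟨1, spinGroup.one_mem, 0, h⟩
  · have hpos : 0 < (off M 0).normSq :=
      lt_of_le_of_ne (normSq_nonneg _) fun h0 => h (normSq_eq_zero h0.symm)
    have hu : ((√(off M 0).normSq)⁻¹ • star (off M 0)).normSq = 1 := by
      rw [normSq_smul, normSq_star, inv_pow, Real.sq_sqrt hpos.le, inv_mul_cancel₀ hpos.ne']
    refine ⟨_, spin_mem_spinGroup _ hu, (√(off M 0).normSq)⁻¹ * (off M 0).normSq, ?_⟩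
    rw [off_spin]
    simp only [Matrix.cons_val, smul_mul_assoc, star_mul_self', smul_ofReal]

/-- A composite of two spin transformations, which conjugates the first off-diagonal entry by `u`. -/
theorem exists_spin_conj (u : Octonion) (hu : u.normSq = 1) : ∃ g ∈ spinGroup, ∀ M,
    off (g M) 0 = (u * off M 0) * star u ∧ off (g M) 1 = (u * (off M 1 * u)) * u := by
  have hu' : (star u).normSq = 1 := by rw [normSq_star, hu]
  -- Conjugation by `cyc` shifts the three roles: the rotated `spin` of `ū` multiplies the first
  -- entry by `ū` on the right and the second by `u` on both sides.
  refine ⟨cyc * spin (star u) hu' * cyc⁻¹ * spin u hu, ?_, fun M => ?_⟩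
  · refine spinGroup.mul_mem ⟨?_, fun d => ?_⟩ (spin_mem_spinGroup u hu)
    · exact E6.mul_mem (E6.mul_mem cyc_mem_E6 (spin_mem_E6 _ _)) (E6.inv_mem cyc_mem_E6)
    · have h : cyc.symm (diag d) = diag fun i => d (i + 2) :=
        J_ext (fun i => by simp [dg_cyc_symm]) fun i => by simp [off_cyc_symm]
      change cyc (spin _ hu' (cyc.symm (diag d))) = _
      rw [h, spin_diag, ← h, LinearEquiv.apply_symm_apply]
  · simp [off_cyc_symm, star_star']

/-- Inside a complex line, `exists_spin_conj` multiplies the second entry by `w³`, so a cube root of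
`z̄ / |z|` makes it real. -/
theorem exists_unit_pow_three_mul (z : ℂ) : ∃ w : ℂ, Complex.normSq w = 1 ∧
    ∃ r : ℝ, w * (z * w) * w = r := by
  rcases eq_or_ne z 0 with rfl | hz
  · exact ⟨1, by simp, 0, by simp⟩
  · obtain ⟨w, hw⟩ := IsAlgClosed.exists_pow_nat_eq (star z / ‖z‖) (n := 3) (by norm_num)
    have hn : ‖w‖ = 1 := by
      have h := congrArg norm hw
      rw [norm_pow, norm_div, norm_star, Complex.norm_real, norm_norm,
        div_self (norm_ne_zero_iff.mpr hz)] at h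
      exact (pow_eq_one_iff_of_nonneg (norm_nonneg w) (by norm_num)).mp h
    refine ⟨w, by rw [Complex.normSq_eq_norm_sq, hn]; norm_num, Complex.normSq z / ‖z‖, ?_⟩
    rw [show w * (z * w) * w = w ^ 3 * z by ring, hw, Complex.ofReal_div,
      Complex.normSq_eq_conj_mul_self, Complex.star_def]
    ring

/-- Every element can be moved, without changing its diagonal, to one whose off-diagonal entries
lie in a common complex line, by an element of `E6` fixing all diagonal matrices. -/
theorem exists_spin_complex (M : J) : ∃ g ∈ spinGroup, ∃ e : Octonion, e.IsImaginaryUnit ∧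
    ∃ z : Fin 3 → ℂ, ∀ i, off (g M) i = ofComplex e (z i) := by
  obtain ⟨g, hg, r, hr⟩ := exists_spin_off_zero M
  obtain ⟨e, he, z, hz⟩ := exists_ofComplex (off (g M) 1)
  obtain ⟨w, hw, s, hs⟩ := exists_unit_pow_three_mul z
  have hu : (ofComplex e w).normSq = 1 := by rw [normSq_ofComplex he, hw]
  -- The first entry is already real, so conjugation by a unit does not change it while the second
  -- becomes real.
  obtain ⟨k, hk, hk'⟩ := exists_spin_conj (ofComplex e w) hu
  have h0 : off (k (g M)) 0 = ofReal r := by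
    rw [(hk' _).1, hr, mul_ofReal, smul_mul_assoc, mul_star_self, hu, smul_ofReal, mul_one]
  have h1 : off (k (g M)) 1 = ofReal s := by
    rw [(hk' _).2, hz, ← ofComplex_mul he, ← ofComplex_mul he, ← ofComplex_mul he, hs,
      ofComplex_ofReal]
  -- Only the third entry can still be non-real, so it alone selects the complex line.
  obtain ⟨e', he', z', hz'⟩ := exists_ofComplex (off (k (g M)) 2)
  refine ⟨k * g, spinGroup.mul_mem hk hg, e', he', ![r, s, z'], fun i => ?_⟩
  fin_cases i
  · simpa [ofComplex_ofReal] using h0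
  · simpa [ofComplex_ofReal] using h1
  · simpa using hz'

end FreudenthalE6

end

noncomputable section

namespace FreudenthalE6

open Octonion Matrix

/-! ### The action of `SL₃(ℂ)` -/

/-- The embedding of the Hermitian complex matrices in the exceptional Jordan algebra defined by
an imaginary unit. -/
def ofMatrix (e : Octonion) (A : Matrix (Fin 3) (Fin 3) ℂ) : J :=
  mk (fun i => (A i i).re) fun i => ofComplex e (A (i + 1) (i + 2))

@[simp] theorem dg_ofMatrix (e : Octonion) (A : Matrix (Fin 3) (Fin 3) ℂ) (i : Fin 3) :
    dg (ofMatrix e A) i = (A i i).re := by simp [ofMatrix]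

@[simp] theorem off_ofMatrix (e : Octonion) (A : Matrix (Fin 3) (Fin 3) ℂ) (i : Fin 3) :
    off (ofMatrix e A) i = ofComplex e (A (i + 1) (i + 2)) := by simp [ofMatrix]

theorem ofMatrix_diagonal (e : Octonion) (d : Fin 3 → ℝ) :
    ofMatrix e (diagonal fun i => (d i : ℂ)) = diag d := by
  refine J_ext (fun i => by simp) fun i => ?_
  have h : i + 1 ≠ i + 2 := by fin_cases i <;> decide
  simp only [off_ofMatrix, off_diag, diagonal_apply_ne _ h]
  simp [ofComplex, show ofReal 0 = 0 from rfl]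

theorem mul_apply_three (g A : Matrix (Fin 3) (Fin 3) ℂ) (i j : Fin 3) :
    (g * A) i j = g i 0 * A 0 j + g i 1 * A 1 j + g i 2 * A 2 j := by
  rw [mul_apply, Fin.sum_univ_three]

theorem mul_mul_conjTranspose_apply (g A : Matrix (Fin 3) (Fin 3) ℂ) (i j : Fin 3) :
    (g * A * gᴴ) i j = (g i 0 * A 0 0 + g i 1 * A 1 0 + g i 2 * A 2 0) * star (g j 0)
      + (g i 0 * A 0 1 + g i 1 * A 1 1 + g i 2 * A 2 1) * star (g j 1)
      + (g i 0 * A 0 2 + g i 1 * A 1 2 + g i 2 * A 2 2) * star (g j 2) := by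
  simp only [mul_apply_three, conjTranspose_apply]

/-- The complex matrix `g` acts on the image of the Hermitian matrices through an element of
`E6`. -/
def ActsByE6 (e : Octonion) (g : Matrix (Fin 3) (Fin 3) ℂ) : Prop :=
  ∃ h ∈ E6, ∀ A : Matrix (Fin 3) (Fin 3) ℂ, A.IsHermitian →
    h (ofMatrix e A) = ofMatrix e (g * A * gᴴ)

theorem ActsByE6.mul {e : Octonion} {g g' : Matrix (Fin 3) (Fin 3) ℂ} (hg : ActsByE6 e g)
    (hg' : ActsByE6 e g') : ActsByE6 e (g * g') := by
  obtain ⟨h, hh, h1⟩ := hg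
  obtain ⟨h', hh', h1'⟩ := hg'
  refine ⟨h * h', E6.mul_mem hh hh', fun A hA => ?_⟩
  rw [LinearEquiv.mul_apply, h1' A hA, h1 _ (isHermitian_mul_mul_conjTranspose g' hA),
    conjTranspose_mul]
  simp only [Matrix.mul_assoc]

theorem actsByE6_cyc (e : Octonion) : ActsByE6 e !![0, 1, 0; 0, 0, 1; 1, 0, 0] := by
  refine ⟨cyc, cyc_mem_E6, fun A hA => J_ext (fun i => ?_) fun i => ?_⟩
  · simp only [dg_cyc, dg_ofMatrix, mul_mul_conjTranspose_apply]
    fin_cases i <;> simp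
  · simp only [off_cyc, off_ofMatrix, mul_mul_conjTranspose_apply]
    fin_cases i <;> simp

theorem actsByE6_cyc_symm (e : Octonion) : ActsByE6 e !![0, 0, 1; 1, 0, 0; 0, 1, 0] := by
  have h := (actsByE6_cyc e).mul (actsByE6_cyc e)
  convert h using 1
  ext i j
  simp only [mul_apply_three]
  fin_cases i <;> fin_cases j <;> simp

theorem actsByE6_swap {e : Octonion} (he : e.IsImaginaryUnit) :
    ActsByE6 e !![0, 1, 0; -1, 0, 0; 0, 0, 1] := by
  refine ⟨swap, swap_mem_E6, fun A hA => J_ext (fun i => ?_) fun i => ?_⟩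
  · rw [dg_swap]
    simp only [dg_ofMatrix, mul_mul_conjTranspose_apply]
    fin_cases i <;> simp
  · rw [off_swap]
    have h : ∀ i j, star (A i j) = A j i := fun i j => hA.apply j i
    simp only [off_ofMatrix, mul_mul_conjTranspose_apply]
    fin_cases i <;>
      simp [star_ofComplex he, h, ofComplex_neg, -RCLike.star_def,
        -Complex.star_def]

theorem actsByE6_swap_symm {e : Octonion} (he : e.IsImaginaryUnit) :
    ActsByE6 e !![0, -1, 0; 1, 0, 0; 0, 0, 1] := by
  -- The matrix of `swap` has order four, so its inverse is its cube.
  have h := ((actsByE6_swap he).mul (actsByE6_swap he)).mul (actsByE6_swap he)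
  convert h using 1
  ext i j
  simp only [mul_apply_three]
  fin_cases i <;> fin_cases j <;> simp

theorem actsByE6_transvec {e : Octonion} (he : e.IsImaginaryUnit) (z : ℂ) :
    ActsByE6 e !![1, z, 0; 0, 1, 0; 0, 0, 1] := by
  refine ⟨transvec (ofComplex e z), transvec_mem_E6 _, fun A hA => J_ext (fun i => ?_)
    fun i => ?_⟩
  · have h : A 1 0 = star (A 0 1) := (hA.apply 1 0).symm
    have h1 := congrArg Complex.im (hA.apply 1 1)
    rw [dg_transvec]
    simp only [dg_ofMatrix, off_ofMatrix, mul_mul_conjTranspose_apply]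
    fin_cases i
    · simp [ip_ofComplex he, normSq_ofComplex he, h,
        Complex.normSq_apply]
      simp at h1
      have h2 : (A 1 1).im = 0 := by linarith
      rw [h2]
      ring
    · simp
    · simp
  · have h : ∀ i j, star (A i j) = A j i := fun i j => hA.apply j i
    have h1 : A 1 1 = ((A 1 1).re : ℂ) := (Complex.conj_eq_iff_re.mp (hA.apply 1 1)).symm
    rw [off_transvec]
    simp only [dg_ofMatrix, off_ofMatrix, mul_mul_conjTranspose_apply]
    fin_cases i
    · simp
    · simp [← ofComplex_mul he, star_ofComplex he,
        ← ofComplex_add, ← h 1 2, mul_comm]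
    · simp [← ofComplex_real_mul, ← ofComplex_add, ← h1, mul_comm]

theorem ActsByE6.congr {e : Octonion} {g g' : Matrix (Fin 3) (Fin 3) ℂ} (hg : ActsByE6 e g)
    (h : ∀ i j, g' i j = g i j) : ActsByE6 e g' := by
  rwa [show g' = g from ext h]

theorem actsByE6_transvection {e : Octonion} (he : e.IsImaginaryUnit) {i j : Fin 3}
    (hij : i ≠ j) (z : ℂ) : ActsByE6 e (Matrix.transvection i j z) := by
  have h01 := actsByE6_transvec he z
  -- Conjugation by `swap` transposes the position and changes the sign, whence `-z`. The other
  -- positions come from conjugation by `cyc`.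
  have h10 := ((actsByE6_swap_symm he).mul (actsByE6_transvec he (-z))).mul (actsByE6_swap he)
  have c := actsByE6_cyc e
  have c' := actsByE6_cyc_symm e
  fin_cases i <;> fin_cases j <;> simp only [Fin.zero_eta, Fin.mk_one, Fin.reduceFinMk] at hij ⊢
  · exact absurd rfl hij
  · refine h01.congr fun i j => ?_
    fin_cases i <;> fin_cases j <;> simp [Matrix.transvection]
  · refine ((c.mul h10).mul c').congr fun i j => ?_
    simp only [mul_apply_three]
    fin_cases i <;> fin_cases j <;> simp [Matrix.transvection]
  · refine h10.congr fun i j => ?_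
    simp only [mul_apply_three]
    fin_cases i <;> fin_cases j <;> simp [Matrix.transvection]
  · exact absurd rfl hij
  · refine ((c'.mul h01).mul c).congr fun i j => ?_
    simp only [mul_apply_three]
    fin_cases i <;> fin_cases j <;> simp [Matrix.transvection]
  · refine ((c.mul h01).mul c').congr fun i j => ?_
    simp only [mul_apply_three]
    fin_cases i <;> fin_cases j <;> simp [Matrix.transvection]
  · refine ((c'.mul h10).mul c).congr fun i j => ?_
    simp only [mul_apply_three]
    fin_cases i <;> fin_cases j <;> simp [Matrix.transvection]
  · exact absurd rfl hij

theorem actsByE6_diagonal_zero_one {e : Octonion} (he : e.IsImaginaryUnit) {a : ℂ} (ha : a ≠ 0) :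
    ActsByE6 e !![a, 0, 0; 0, a⁻¹, 0; 0, 0, 1] := by
  -- With `E₁₂`, `E₂₁` the elementary matrices, `E₁₂(a) E₂₁(-a⁻¹) E₁₂(a)` is antidiagonal on the
  -- first two coordinates; a final signed permutation makes it diagonal.
  have h := actsByE6_transvec he a
  have h' := ((actsByE6_swap_symm he).mul (actsByE6_transvec he a⁻¹)).mul (actsByE6_swap he)
  refine (((h.mul h').mul h).mul (actsByE6_swap_symm he)).congr fun i j => ?_
  simp only [mul_apply_three]
  fin_cases i <;> fin_cases j <;> simp [ha]

theorem actsByE6_diag2n {e : Octonion} (he : e.IsImaginaryUnit) {i j : Fin 3} (hij : i ≠ j)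
    {a : ℂ} (ha : a ≠ 0) : ActsByE6 e (SpecialLinearGroup.diag2n hij a ha).1 := by
  have h01 := actsByE6_diagonal_zero_one he ha
  have h10 := actsByE6_diagonal_zero_one he (inv_ne_zero ha)
  have c := actsByE6_cyc e
  have c' := actsByE6_cyc_symm e
  rw [SpecialLinearGroup.diag2n_coe]
  fin_cases i <;> fin_cases j <;> simp only [Fin.zero_eta, Fin.mk_one, Fin.reduceFinMk] at hij ⊢
  · exact absurd rfl hij
  · refine h01.congr fun i j => ?_
    fin_cases i <;> fin_cases j <;> simp
  · refine ((c.mul h10).mul c').congr fun i j => ?_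
    simp only [mul_apply_three]
    fin_cases i <;> fin_cases j <;> simp
  · refine h10.congr fun i j => ?_
    fin_cases i <;> fin_cases j <;> simp
  · exact absurd rfl hij
  · refine ((c'.mul h01).mul c).congr fun i j => ?_
    simp only [mul_apply_three]
    fin_cases i <;> fin_cases j <;> simp
  · refine ((c.mul h01).mul c').congr fun i j => ?_
    simp only [mul_apply_three]
    fin_cases i <;> fin_cases j <;> simp
  · refine ((c'.mul h10).mul c).congr fun i j => ?_
    simp only [mul_apply_three]
    fin_cases i <;> fin_cases j <;> simp
  · exact absurd rfl hij

theorem actsByE6_of_specialLinearGroup {e : Octonion} (he : e.IsImaginaryUnit)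
    (g : SpecialLinearGroup (Fin 3) ℂ) : ActsByE6 e g.1 :=
  SpecialLinearGroup.diagonal_transvection_induction' (fun g => ActsByE6 e g.1) g
    (fun _ _ hij _ hc => actsByE6_diag2n he hij hc)
    (fun _ _ hij a => actsByE6_transvection he hij a) fun _ _ hA hB => hA.mul hB

end FreudenthalE6

end

noncomputable section

namespace FreudenthalE6

open Octonion Matrix

/-! ### Diagonalization -/

theorem exists_specialUnitary_diagonal {A : Matrix (Fin 3) (Fin 3) ℂ} (hA : A.IsHermitian) :
    ∃ (U : SpecialLinearGroup (Fin 3) ℂ) (d : Fin 3 → ℝ), U.1 * U.1ᴴ = 1 ∧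
      A = U.1 * diagonal (fun i => (d i : ℂ)) * U.1ᴴ := by
  set V : Matrix (Fin 3) (Fin 3) ℂ := hA.eigenvectorUnitary.1 with hV
  have hVV : V * Vᴴ = 1 := Unitary.mul_star_self_of_mem hA.eigenvectorUnitary.2
  have hdet : V.det * star V.det = 1 := by
    rw [← det_conjTranspose, ← det_mul, hVV, det_one]
  -- Rescaling one eigenvector by the unit scalar `star V.det` brings the determinant to one without
  -- affecting the diagonalization.
  set E : Matrix (Fin 3) (Fin 3) ℂ := diagonal ![star V.det, 1, 1] with hE
  have hEE : ∀ d : Fin 3 → ℂ, E * diagonal d * Eᴴ = diagonal d := fun d => by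
    rw [hE, diagonal_conjTranspose, diagonal_mul_diagonal, diagonal_mul_diagonal]
    congr 1
    funext i
    fin_cases i
    · simp only [Fin.zero_eta, Matrix.cons_val, Pi.star_apply, star_star]
      linear_combination d 0 * hdet
    · simp
    · simp
  refine ⟨⟨V * E, ?_⟩, hA.eigenvalues, ?_, ?_⟩
  · rw [det_mul, hE, det_diagonal, Fin.prod_univ_three]
    simpa using hdet
  · have h := hEE 1
    rw [Pi.one_def, diagonal_one, Matrix.mul_one] at h
    rw [conjTranspose_mul, Matrix.mul_assoc, ← Matrix.mul_assoc E, h, Matrix.one_mul, hVV]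
  · have h := hA.spectral_theorem
    rw [Unitary.conjStarAlgAut_apply] at h
    rw [conjTranspose_mul, Matrix.mul_assoc, Matrix.mul_assoc, ← Matrix.mul_assoc _ Eᴴ,
      ← Matrix.mul_assoc E, ← Matrix.mul_assoc E, hEE, ← Matrix.mul_assoc]
    exact h

theorem ofMatrix_one (e : Octonion) : ofMatrix e 1 = one := by
  have h := ofMatrix_diagonal e fun _ => 1
  rwa [Complex.ofReal_one, diagonal_one] at h

theorem isHermitian_diagonal_ofReal (d : Fin 3 → ℝ) :
    (diagonal fun i => (d i : ℂ)).IsHermitian := by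
  rw [IsHermitian, diagonal_conjTranspose]
  congr 1
  funext i
  simp

/-- The element of `E6` induced by a special unitary matrix fixes `one`, because `U Uᴴ = 1`. -/
theorem exists_F4_of_unitary {e : Octonion} (he : e.IsImaginaryUnit)
    {U : SpecialLinearGroup (Fin 3) ℂ} (hU : U.1 * U.1ᴴ = 1) :
    ∃ k ∈ F4, ∀ d : Fin 3 → ℝ,
      k (diag d) = ofMatrix e (U.1 * diagonal (fun i => (d i : ℂ)) * U.1ᴴ) := by
  obtain ⟨h, hh, h1⟩ := actsByE6_of_specialLinearGroup he U
  refine ⟨h, ⟨hh, ?_⟩, fun d => ?_⟩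
  · rw [← ofMatrix_one e, h1 _ isHermitian_one, Matrix.mul_one, hU]
  · rw [← ofMatrix_diagonal e, h1 _ (isHermitian_diagonal_ofReal d)]

theorem mem_F4_of_mem_spinGroup {g : J ≃ₗ[ℝ] J} (hg : g ∈ spinGroup) : g ∈ F4 :=
  ⟨hg.1, hg.2 _⟩

theorem exists_spin_ofMatrix (M : J) : ∃ g ∈ spinGroup, ∃ e : Octonion, e.IsImaginaryUnit ∧
    ∃ A : Matrix (Fin 3) (Fin 3) ℂ, A.IsHermitian ∧ g M = ofMatrix e A := by
  obtain ⟨g, hg, e, he, z, hz⟩ := exists_spin_complex M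
  refine ⟨g, hg, e, he, !![(dg (g M) 0 : ℂ), z 2, star (z 1); star (z 2), (dg (g M) 1 : ℂ), z 0;
    z 1, star (z 0), (dg (g M) 2 : ℂ)], ?_, J_ext (fun i => ?_) fun i => ?_⟩
  · refine IsHermitian.ext fun i j => ?_
    fin_cases i <;> fin_cases j <;> simp
  · fin_cases i <;> simp
  · fin_cases i <;> simp [hz]

/-- Every element of the exceptional Jordan algebra is diagonalized by an element of `F4`. -/
theorem exists_F4_diag (M : J) : ∃ k ∈ F4, ∃ d : Fin 3 → ℝ, M = k (diag d) := by
  obtain ⟨g, hg, e, he, A, hA, hgA⟩ := exists_spin_ofMatrix M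
  obtain ⟨U, d, hU, rfl⟩ := exists_specialUnitary_diagonal hA
  obtain ⟨k, hk, hkd⟩ := exists_F4_of_unitary he hU
  refine ⟨g⁻¹ * k, F4.mul_mem (F4.inv_mem (mem_F4_of_mem_spinGroup hg)) hk, d, ?_⟩
  rw [LinearEquiv.mul_apply, hkd, ← hgA]
  exact (g.symm_apply_apply M).symm

/-! ### Positivity -/

theorem det_diag (d : Fin 3 → ℝ) : det (diag d) = ∏ i, d i := by
  rw [det_eq, Fin.prod_univ_three]
  simp [normSq, tri]

theorem det_one' : det one = 1 := by
  rw [one, det_diag]; simp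

/-- The difference is `tr (M ⋆ M)`, a sum of squares: every characteristic polynomial is
real-rooted, and this is the only trace of it needed. -/
theorem two_mul_quad_le (M : J) : 2 * quad M ≤ tr M ^ 2 := by
  have h := fun i => (off M i).normSq_nonneg
  have h0 := h 0
  have h1 := h 1
  have h2 := h 2
  simp only [quad, tr]
  nlinarith [sq_nonneg (dg M 0), sq_nonneg (dg M 1), sq_nonneg (dg M 2)]

/-- An algebraic substitute for connectedness of `E6`: a negative `p i` would produce an element of
`J` whose characteristic polynomial `t³ - p i t` has non-real roots. -/
theorem pos_of_map_one_eq_diag {h : J ≃ₗ[ℝ] J} (hh : h ∈ E6) {p : Fin 3 → ℝ}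
    (hp : h one = diag p) (i : Fin 3) : 0 < p i := by
  have hprod : ∏ i, p i = 1 := by rw [← det_diag, ← hp, hh, det_one']
  have hne : p i ≠ 0 := fun h0 => by
    rw [Finset.prod_eq_zero (Finset.mem_univ i) h0] at hprod
    exact zero_ne_one hprod
  rw [Fin.prod_univ_three] at hprod
  -- A single off-diagonal unit: `det (t • diag p - Q) = t³ ∏ p - t p i`, with `∏ p = 1`.
  set Q : J := mk 0 (Pi.single i (ofReal 1)) with hQ
  have key : ∀ t : ℝ, det (t • one - h.symm Q) = t ^ 3 - p i * t := fun t => by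
    rw [← hh, map_sub, map_smul, hp, LinearEquiv.apply_symm_apply]
    simp only [det_eq, dg_sub, dg_smul, dg_diag, hQ, dg_mk, Pi.zero_apply]
    fin_cases i <;> simp [normSq, tri] <;> linear_combination t ^ 3 * hprod
  simp only [det_smul_one_sub] at key
  have k1 := key 1
  have k2 := key (-1)
  have k0 := key 0
  have htr : tr (h.symm Q) = 0 := by linarith
  have hqu : quad (h.symm Q) = -p i := by linarith
  have hle := two_mul_quad_le (h.symm Q)
  rw [htr, hqu] at hle
  exact lt_of_le_of_ne (by linarith) hne.symm

theorem exists_isImaginaryUnit : ∃ e : Octonion, e.IsImaginaryUnit :=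
  let ⟨e, he, _⟩ := exists_ofComplex 0
  ⟨e, he⟩

theorem exists_E6_one_eq_diag {d : Fin 3 → ℝ} (hd : ∏ i, d i = 1) :
    ∃ h ∈ E6, h one = diag fun i => d i * d i := by
  obtain ⟨e, he⟩ := exists_isImaginaryUnit
  have hdet : (diagonal fun i => (d i : ℂ)).det = 1 := by
    rw [det_diagonal, ← Complex.ofReal_prod, hd, Complex.ofReal_one]
  obtain ⟨h, hh, h1⟩ := actsByE6_of_specialLinearGroup he ⟨_, hdet⟩
  refine ⟨h, hh, ?_⟩
  rw [← ofMatrix_one e, h1 _ isHermitian_one, Matrix.mul_one, isHermitian_diagonal_ofReal d,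
    diagonal_mul_diagonal, ← ofMatrix_diagonal e]
  simp

theorem exists_F4_map_one {h : J ≃ₗ[ℝ] J} (hh : h ∈ E6) : ∃ k ∈ F4, ∃ d : Fin 3 → ℝ,
    (∀ i, 0 < d i) ∧ ∏ i, d i = 1 ∧ h one = k (diag fun i => d i * d i) := by
  obtain ⟨k, hk, p, hp⟩ := exists_F4_diag (h one)
  have hp' : (k⁻¹ * h) one = diag p := k.symm_apply_eq.mpr hp
  have hpos := pos_of_map_one_eq_diag (E6.mul_mem (E6.inv_mem hk.1) hh) hp'
  have hprod : ∏ i, p i = 1 := by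
    rw [← det_diag, ← hk.1 (diag p), ← hp, hh, det_one']
  refine ⟨k, hk, fun i => √(p i), fun i => Real.sqrt_pos.mpr (hpos i), ?_, ?_⟩
  · rw [← Real.sqrt_prod _ fun i _ => (hpos i).le, hprod, Real.sqrt_one]
  · simp only [Real.mul_self_sqrt (hpos _).le, hp]

/-- The element `k (diag d)` of the symmetric space. -/
def XO.ofDiag {k : J ≃ₗ[ℝ] J} (hk : k ∈ F4) {d : Fin 3 → ℝ} (hd : ∀ i, 0 < d i)
    (hd' : ∏ i, d i = 1) : XO :=
  ⟨k (diag d), by rw [hk.1, det_diag, hd'],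
    ⟨k⁻¹, F4.inv_mem hk, d, hd, k.symm_apply_apply _⟩⟩

theorem exists_XO_jmul_self {h : J ≃ₗ[ℝ] J} (hh : h ∈ E6) :
    ∃ N : XO, jmul N.1 N.1 = h one := by
  obtain ⟨k, hk, d, hd, hd', h1⟩ := exists_F4_map_one hh
  refine ⟨XO.ofDiag hk hd hd', ?_⟩
  rw [h1, ← jmul_diag_diag, map_jmul_of_mem_F4 hk]
  rfl

/-- Transitivity of `E6`; with `exists_XO_jmul_self` and `XO_ext`, squaring is a bijection from
`X_O` to the orbit of `one`. -/
theorem exists_E6_jmul_self (N : XO) : ∃ h ∈ E6, jmul N.1 N.1 = h one := by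
  obtain ⟨hdet, k, hk, d, hd, hkd⟩ := N.2
  have hprod : ∏ i, d i = 1 := by rw [← det_diag, ← hkd, hk.1, hdet]
  obtain ⟨h, hh, h1⟩ := exists_E6_one_eq_diag hprod
  refine ⟨k⁻¹ * h, E6.mul_mem (E6.inv_mem hk.1) hh, ?_⟩
  rw [LinearEquiv.mul_apply, h1, ← jmul_diag_diag, ← hkd, ← map_jmul_of_mem_F4 hk]
  exact (k.symm_apply_apply _).symm

theorem tr_jmul_jmul_diag (w : J) (a : Fin 3 → ℝ) : tr (jmul w (jmul w (diag a))) =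
    a 0 * dg w 0 ^ 2 + a 1 * dg w 1 ^ 2 + a 2 * dg w 2 ^ 2 + (a 1 + a 2) * (off w 0).normSq
      + (a 2 + a 0) * (off w 1).normSq + (a 0 + a 1) * (off w 2).normSq := by
  simp [tr, dg_jmul, off_jmul, ip_smul_right, ip_self, ip_zero_right, star_zero']
  ring

/-- Jordan multiplication by a positive element is positive definite for the trace form; after
diagonalizing `x` by `F4` the form is a positive combination of squares. -/
theorem tr_jmul_jmul_pos {x : J} (hx : IsPositive x) {w : J} (hw : w ≠ 0) :
    0 < tr (jmul w (jmul w x)) := by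
  obtain ⟨k, hk, a, ha, hka⟩ := hx
  rw [← tr_jmul_of_mem_F4 hk, map_jmul_of_mem_F4 hk, hka, tr_jmul_jmul_diag]
  set v := k w with hv
  have h0 := ha 0
  have h1 := ha 1
  have h2 := ha 2
  have n := fun i => (off v i).normSq_nonneg
  have n0 := n 0
  have n1 := n 1
  have n2 := n 2
  by_contra hle
  have s : ∀ i, a i * dg v i ^ 2 = 0 ∧ (a (i + 1) + a (i + 2)) * (off v i).normSq = 0 := by
    have q0 : 0 ≤ a 0 * dg v 0 ^ 2 := by positivity
    have q1 : 0 ≤ a 1 * dg v 1 ^ 2 := by positivity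
    have q2 : 0 ≤ a 2 * dg v 2 ^ 2 := by positivity
    have r0 : 0 ≤ (a 1 + a 2) * (off v 0).normSq := by positivity
    have r1 : 0 ≤ (a 2 + a 0) * (off v 1).normSq := by positivity
    have r2 : 0 ≤ (a 0 + a 1) * (off v 2).normSq := by positivity
    intro i
    fin_cases i <;> simp only [Fin.zero_eta, Fin.mk_one, Fin.reduceFinMk, Fin.isValue,
      Fin.reduceAdd, zero_add] <;> constructor <;> linarith
  have hv0 : v = 0 := J_ext (fun i => by
      have := (mul_eq_zero.mp (s i).1).resolve_left (ha i).ne'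
      simpa using this) fun i =>
    normSq_eq_zero ((mul_eq_zero.mp (s i).2).resolve_left (add_pos (ha _) (ha _)).ne')
  exact hw (k.map_eq_zero_iff.mp hv0)

/-- Uniqueness of the positive square root: `(M - N) ⋆ (M + N) = 0` by commutativity, while
multiplication by `M + N` is positive definite. -/
theorem XO_ext {M N : XO} (h : jmul M.1 M.1 = jmul N.1 N.1) : M = N := by
  apply Subtype.ext
  by_contra hne
  have hw : M.1 - N.1 ≠ 0 := sub_ne_zero.mpr hne
  have h0 : jmul (M.1 - N.1) (M.1 + N.1) = 0 := by
    have h1 : jmul (N.1 + (M.1 - N.1)) (M.1 + N.1) = jmul N.1 (M.1 + N.1) := by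
      rw [add_sub_cancel, jmul_add, jmul_add, h, jmul_comm M.1, add_comm]
    rw [add_jmul] at h1
    exact left_eq_add.mp h1.symm
  have h1 := add_pos (tr_jmul_jmul_pos M.2.2 hw) (tr_jmul_jmul_pos N.2.2 hw)
  rw [← tr_add, ← jmul_add, ← jmul_add, h0] at h1
  simp [tr, dg_jmul, ip_zero_right] at h1

/-- The element is a Jordan square `N ⋆ N`, so its diagonal entry is the squared length of a row of
`N`; if it vanishes, so does that row. -/
theorem dg_map_diag_nonneg_of_F4 {k : J ≃ₗ[ℝ] J} (hk : k ∈ F4) {p : Fin 3 → ℝ}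
    (hp : ∀ i, 0 ≤ p i) (i : Fin 3) : 0 ≤ dg (k (diag p)) i ∧
      (dg (k (diag p)) i = 0 → off (k (diag p)) (i + 1) = 0 ∧ off (k (diag p)) (i + 2) = 0) := by
  set N := k (diag fun i => √(p i)) with hN
  have h : k (diag p) = jmul N N := by
    rw [hN, ← map_jmul_of_mem_F4 hk, jmul_diag_diag]
    simp only [Real.mul_self_sqrt (hp _)]
  have h0 := mul_self_nonneg (dg N i)
  have h1 := (off N (i + 1)).normSq_nonneg
  have h2 := (off N (i + 2)).normSq_nonneg
  rw [h, dg_jmul, ip_self, ip_self]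
  refine ⟨by positivity, fun hz => ?_⟩
  have e0 : dg N i = 0 := mul_self_eq_zero.mp (by linarith)
  have e1 : off N (i + 1) = 0 := normSq_eq_zero (by linarith)
  have e2 : off N (i + 2) = 0 := normSq_eq_zero (by linarith)
  constructor
  · simp [off_jmul, add_assoc, e1, e2, star_zero']
  · simp [off_jmul, add_assoc, e1, e2, star_zero']

/-- The part of cone invariance under `E6` that is needed. A positive diagonal matrix is a multiple
of an element of the orbit of `one`, and that orbit consists of squares; a perturbation by `δ • one`
reaches the boundary. -/
theorem dg_map_diag_nonneg {h : J ≃ₗ[ℝ] J} (hh : h ∈ E6) {p : Fin 3 → ℝ} (hp : ∀ i, 0 ≤ p i)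
    (i : Fin 3) : 0 ≤ dg (h (diag p)) i := by
  have hone : ∀ {h : J ≃ₗ[ℝ] J}, h ∈ E6 → 0 ≤ dg (h one) i := fun hh => by
    obtain ⟨k, hk, d, hd, -, h1⟩ := exists_F4_map_one hh
    rw [h1]
    exact (dg_map_diag_nonneg_of_F4 hk (fun i => (mul_pos (hd i) (hd i)).le) i).1
  have hpos : ∀ {q : Fin 3 → ℝ}, (∀ i, 0 < q i) → 0 ≤ dg (h (diag q)) i := fun {q} hq => by
    have hP : 0 < ∏ i, q i := Finset.prod_pos fun i _ => hq i
    set c : ℝ := (∏ i, q i) ^ (3⁻¹ : ℝ) with hc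
    have hc0 : 0 < c := Real.rpow_pos_of_pos hP _
    have hc3 : c ^ 3 = ∏ i, q i := by
      rw [hc, ← Real.rpow_natCast, ← Real.rpow_mul hP.le]; norm_num
    have hq' : ∀ i, 0 ≤ q i / c := fun i => (div_pos (hq i) hc0).le
    have hprod : ∏ i, √(q i / c) = 1 := by
      rw [← Real.sqrt_prod _ fun i _ => hq' i, Finset.prod_div_distrib, Finset.prod_const,
        Finset.card_univ, Fintype.card_fin, hc3, div_self hP.ne', Real.sqrt_one]
    obtain ⟨h', hh', h1⟩ := exists_E6_one_eq_diag hprod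
    have h2 : diag q = c • h' one := by
      rw [h1]
      refine J_ext (fun i => ?_) fun i => by simp
      simp only [dg_diag, dg_smul, Real.mul_self_sqrt (hq' i)]
      field_simp
    rw [h2, map_smul, dg_smul]
    exact mul_nonneg hc0.le (hone (E6.mul_mem hh hh'))
  refine le_of_forall_pos_le_add fun ε hε => ?_
  have h1 := hone hh
  set δ := ε / (dg (h one) i + 1) with hδ
  have hδ0 : 0 < δ := by positivity
  have h2 := hpos (q := fun i => p i + δ) fun i => add_pos_of_nonneg_of_pos (hp i) hδ0
  have h3 : diag (fun i => p i + δ) = diag p + δ • one :=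
    J_ext (fun i => by simp) fun i => by simp
  rw [h3, map_add, map_smul, dg_add, dg_smul] at h2
  have h4 : δ * dg (h one) i ≤ ε := by
    rw [hδ, div_mul_eq_mul_div, div_le_iff₀ (by positivity)]
    nlinarith
  linarith

/-! ### The distance -/

theorem le_max3 (d : Fin 3 → ℝ) (i : Fin 3) : d i ≤ max3 d := by
  unfold max3
  fin_cases i <;> simp

theorem max3_le {d : Fin 3 → ℝ} {c : ℝ} (h : ∀ i, d i ≤ c) : max3 d ≤ c :=
  max_le (max_le (h 0) (h 1)) (h 2)

theorem max3_le_max3 {d d' : Fin 3 → ℝ} (h : ∀ i, ∃ j, d i = d' j) : max3 d ≤ max3 d' :=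
  max3_le fun i => by
    obtain ⟨j, hj⟩ := h i
    rw [hj]
    exact le_max3 d' j

/-- The squares of the `d i` are the roots of `det (t • M² - N²)` for the two image points' squares
`M²`, `N²`, so they do not depend on the frame. This makes the set defining `distO` a singleton. -/
theorem exists_eq_of_map_diag {g g' : J ≃ₗ[ℝ] J} (hg : g ∈ E6) (hg' : g' ∈ E6)
    {d d' : Fin 3 → ℝ} (hd : ∀ i, 0 < d i) (hd' : ∀ i, 0 < d' i) (h1 : g one = g' one)
    (h2 : g (diag fun i => d i * d i) = g' (diag fun i => d' i * d' i)) (i : Fin 3) :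
    ∃ j, d i = d' j := by
  have key : ∀ t : ℝ, det (t • one - diag fun i => d i * d i) =
      det (t • one - diag fun i => d' i * d' i) := fun t => by
    rw [← hg, ← hg' (t • one - _), map_sub, map_sub, map_smul, map_smul, h1, h2]
  have hdet : ∀ (t : ℝ) (p : Fin 3 → ℝ), det (t • one - diag p) = ∏ j, (t - p j) := fun t p => by
    rw [← det_diag]
    congr 1
    exact J_ext (fun i => by simp) fun i => by simp
  have h0 := key (d i * d i)
  rw [hdet, hdet, Finset.prod_eq_zero (Finset.mem_univ i) (sub_self _)] at h0
  obtain ⟨j, -, hj⟩ := Finset.prod_eq_zero_iff.mp h0.symm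
  exact ⟨j, (mul_self_inj (hd i).le (hd' j).le).mp (sub_eq_zero.mp hj)⟩

theorem jmul_one_one : jmul one one = one := by
  simp [one, jmul_diag_diag]

theorem distO_eq {g : J ≃ₗ[ℝ] J} (hg : g ∈ E6) {d : Fin 3 → ℝ} (hd : ∀ i, 0 < d i)
    (hprod : ∏ i, d i = 1) {M N : XO} (hM : jmul M.1 M.1 = g one)
    (hN : jmul N.1 N.1 = g (diag fun i => d i * d i)) :
    distO M N = Real.log (max3 d) + Real.log (max3 fun i => (d i)⁻¹) := by
  have hset : {r | ∃ (g : E6) (d : Fin 3 → ℝ), (∀ i, 0 < d i) ∧ ∏ i, d i = 1 ∧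
      IsActO g one M ∧ IsActO g (diag d) N ∧
      r = Real.log (max3 d) + Real.log (max3 fun i => (d i)⁻¹)} =
      {Real.log (max3 d) + Real.log (max3 fun i => (d i)⁻¹)} := by
    refine Set.eq_singleton_iff_unique_mem.mpr ⟨⟨⟨g, hg⟩, d, hd, hprod, ?_, ?_, rfl⟩, ?_⟩
    · rw [IsActO, jmul_one_one, hM]
    · rw [IsActO, jmul_diag_diag, hN]
    · rintro r ⟨g', d', hd', -, hM', hN', rfl⟩
      rw [IsActO, jmul_one_one, hM] at hM'
      rw [IsActO, jmul_diag_diag, hN] at hN'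
      have e1 := exists_eq_of_map_diag hg g'.2 hd hd' hM' hN'
      have e2 := exists_eq_of_map_diag g'.2 hg hd' hd hM'.symm hN'.symm
      congr 2
      · exact le_antisymm (max3_le_max3 e2) (max3_le_max3 e1)
      · exact le_antisymm (max3_le_max3 fun i => (e2 i).imp fun j hj => by rw [hj])
          (max3_le_max3 fun i => (e1 i).imp fun j hj => by rw [hj])
  rw [distO, hset, csInf_singleton]

theorem exists_relative_position {g : J ≃ₗ[ℝ] J} (hg : g ∈ E6) (N : XO) :
    ∃ k ∈ F4, ∃ d : Fin 3 → ℝ, (∀ i, 0 < d i) ∧ ∏ i, d i = 1 ∧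
      jmul N.1 N.1 = g (k (diag fun i => d i * d i)) := by
  obtain ⟨h, hh, hN⟩ := exists_E6_jmul_self N
  obtain ⟨k, hk, d, hd, hd', h1⟩ := exists_F4_map_one (E6.mul_mem (E6.inv_mem hg) hh)
  refine ⟨k, hk, d, hd, hd', ?_⟩
  rw [← h1, hN]
  exact (g.apply_symm_apply _).symm

end FreudenthalE6

end

noncomputable section

namespace FreudenthalE6

open Octonion Matrix
open scoped ComplexOrder

/-! ### Positive definite complex matrices -/

theorem exists_unitary_diagonal_sq {e : Octonion} (he : e.IsImaginaryUnit)
    {B : Matrix (Fin 3) (Fin 3) ℂ} (hB : B.IsHermitian) {h : J ≃ₗ[ℝ] J} (hh : h ∈ E6)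
    (hBh : ofMatrix e B = h one) :
    ∃ (U : SpecialLinearGroup (Fin 3) ℂ) (d : Fin 3 → ℝ), U.1 * U.1ᴴ = 1 ∧ (∀ i, 0 < d i) ∧
      ∏ i, d i = 1 ∧ B = U.1 * diagonal (fun i => ((d i * d i : ℝ) : ℂ)) * U.1ᴴ := by
  obtain ⟨U, p, hU, rfl⟩ := exists_specialUnitary_diagonal hB
  obtain ⟨k, hk, hkd⟩ := exists_F4_of_unitary he hU
  rw [← hkd] at hBh
  have hp : (k⁻¹ * h) one = diag p := k.symm_apply_eq.mpr hBh.symm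
  have hpos := pos_of_map_one_eq_diag (E6.mul_mem (E6.inv_mem hk.1) hh) hp
  have hprod : ∏ i, p i = 1 := by
    rw [← det_diag, ← hk.1 (diag p), hBh, hh, det_one']
  refine ⟨U, fun i => √(p i), hU, fun i => Real.sqrt_pos.mpr (hpos i), ?_, ?_⟩
  · rw [← Real.sqrt_prod _ fun i _ => (hpos i).le, hprod, Real.sqrt_one]
  · simp only [Real.mul_self_sqrt (hpos _).le]

theorem conjTranspose_mul_self_of_unitary {U : Matrix (Fin 3) (Fin 3) ℂ} (hU : U * Uᴴ = 1) :
    Uᴴ * U = 1 := mul_eq_one_comm.mp hU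

/-- Recognizes the squares of points of `X_C`: positivity of the eigenvalues is inherited from the
`E6`-orbit of `one`. Every membership in the image of an embedding goes through this. -/
theorem exists_XC_mul_self {e : Octonion} (he : e.IsImaginaryUnit)
    {B : Matrix (Fin 3) (Fin 3) ℂ} (hB : B.IsHermitian) {h : J ≃ₗ[ℝ] J} (hh : h ∈ E6)
    (hBh : ofMatrix e B = h one) : ∃ A : XC, A.1 * A.1 = B := by
  obtain ⟨U, d, hU, hd, hprod, rfl⟩ := exists_unitary_diagonal_sq he hB hh hBh
  refine ⟨⟨U.1 * diagonal (fun i => (d i : ℂ)) * U.1ᴴ, ?_, ?_⟩, ?_⟩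
  · have hD : (diagonal fun i => (d i : ℂ)).PosDef :=
      PosDef.diagonal fun i => by exact_mod_cast hd i
    refine hD.mul_mul_conjTranspose_same ?_
    exact Matrix.vecMul_injective_of_isUnit (IsUnit.of_mul_eq_one _ hU)
  · rw [det_mul, det_mul, mul_right_comm, ← det_mul, hU, det_one, one_mul, det_diagonal,
      ← Complex.ofReal_prod, hprod, Complex.ofReal_one]
  · have h2 : (diagonal fun i => ((d i * d i : ℝ) : ℂ)) =
        diagonal (fun i => (d i : ℂ)) * diagonal fun i => (d i : ℂ) := by
      rw [diagonal_mul_diagonal]; simp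
    rw [h2]
    simp only [Matrix.mul_assoc]
    rw [← Matrix.mul_assoc U.1ᴴ U.1, conjTranspose_mul_self_of_unitary hU, Matrix.one_mul]

theorem exists_E6_ofMatrix_mul {e : Octonion} (he : e.IsImaginaryUnit)
    (g : SpecialLinearGroup (Fin 3) ℂ) : ∃ h ∈ E6, h one = ofMatrix e (g.1 * g.1ᴴ) ∧
      ∀ d : Fin 3 → ℝ,
        h (diag d) = ofMatrix e (g.1 * diagonal (fun i => (d i : ℂ)) * g.1ᴴ) := by
  obtain ⟨h, hh, h1⟩ := actsByE6_of_specialLinearGroup he g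
  refine ⟨h, hh, ?_, fun d => ?_⟩
  · rw [← ofMatrix_one e, h1 _ isHermitian_one, Matrix.mul_one]
  · rw [← ofMatrix_diagonal e, h1 _ (isHermitian_diagonal_ofReal d)]

theorem XC.isHermitian (A : XC) : A.1ᴴ = A.1 := A.2.1.1

theorem XC.isUnit_det (A : XC) : IsUnit A.1.det := by
  rw [A.2.2]; exact isUnit_one

theorem XC.inv_mul (A : XC) : A.1⁻¹ * A.1 = 1 := nonsing_inv_mul _ A.isUnit_det

theorem XC.mul_inv (A : XC) : A.1 * A.1⁻¹ = 1 := mul_nonsing_inv _ A.isUnit_det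

theorem XC.inv_conjTranspose (A : XC) : A.1⁻¹ᴴ = A.1⁻¹ := by
  rw [conjTranspose_nonsing_inv, A.isHermitian]

theorem exists_relative_position_XC (A B : XC) :
    ∃ (g : SpecialLinearGroup (Fin 3) ℂ) (d : Fin 3 → ℝ), (∀ i, 0 < d i) ∧ ∏ i, d i = 1 ∧
      A.1 * A.1 = g.1 * g.1ᴴ ∧
      B.1 * B.1 = g.1 * diagonal (fun i => ((d i * d i : ℝ) : ℂ)) * g.1ᴴ := by
  obtain ⟨e, he⟩ := exists_isImaginaryUnit
  have hdet : (A.1⁻¹ * B.1).det = 1 := by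
    rw [det_mul, det_nonsing_inv, A.2.2, B.2.2, Ring.inverse_one, one_mul]
  obtain ⟨h, hh, h1, -⟩ := exists_E6_ofMatrix_mul he ⟨A.1⁻¹ * B.1, hdet⟩
  -- Singular values of `A⁻¹ B`: with `(A⁻¹ B)(A⁻¹ B)ᴴ = U D² Uᴴ`, the frame is `g = A U`.
  obtain ⟨U, d, hU, hd, hprod, hC⟩ :=
    exists_unitary_diagonal_sq he (isHermitian_mul_conjTranspose_self _) hh h1.symm
  refine ⟨⟨A.1 * U.1, by rw [det_mul, A.2.2, U.2, one_mul]⟩, d, hd, hprod, ?_, ?_⟩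
  · rw [conjTranspose_mul, A.isHermitian, Matrix.mul_assoc, ← Matrix.mul_assoc U.1, hU,
      Matrix.one_mul]
  · have h2 : A.1 * U.1 * diagonal (fun i => ((d i * d i : ℝ) : ℂ)) * (A.1 * U.1)ᴴ =
        A.1 * (U.1 * diagonal (fun i => ((d i * d i : ℝ) : ℂ)) * U.1ᴴ) * A.1 := by
      rw [conjTranspose_mul, A.isHermitian]
      simp only [Matrix.mul_assoc]
    rw [h2, ← hC, conjTranspose_mul, B.isHermitian, A.inv_conjTranspose]
    simp only [Matrix.mul_assoc]
    rw [A.inv_mul, Matrix.mul_one, ← Matrix.mul_assoc, A.mul_inv, Matrix.one_mul]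

theorem max3_pos {d : Fin 3 → ℝ} (h : ∀ i, 0 < d i) : 0 < max3 d :=
  (h 0).trans_le (le_max3 d 0)

theorem max3_mul_self {d : Fin 3 → ℝ} (h : ∀ i, 0 < d i) :
    max3 (fun i => d i * d i) = max3 d * max3 d := by
  have hp := max3_pos h
  refine le_antisymm (max3_le fun i => mul_self_le_mul_self (h i).le (le_max3 d i)) ?_
  rw [← Real.sqrt_le_sqrt_iff (max3_pos fun i => mul_pos (h i) (h i)).le,
    Real.sqrt_mul_self hp.le]
  exact max3_le fun i => Real.le_sqrt_of_sq_le
    ((sq (d i)).le.trans (le_max3 (fun i => d i * d i) i))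

open scoped Matrix.Norms.L2Operator in
theorem opNorm_inv_mul {A B : XC} {g : Matrix (Fin 3) (Fin 3) ℂ} {d : Fin 3 → ℝ}
    (hd : ∀ i, 0 < d i) (hA : A.1 * A.1 = g * gᴴ)
    (hB : B.1 * B.1 = g * diagonal (fun i => ((d i * d i : ℝ) : ℂ)) * gᴴ) :
    opNorm (A.1⁻¹ * B.1) = max3 d := by
  -- This matrix is unitary because `A² = g gᴴ`, and the C⋆-identity reduces the norm of `A⁻¹ B` to
  -- that of the diagonal matrix.
  set V := A.1⁻¹ * g with hV
  have hVV : V * Vᴴ = 1 := by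
    rw [hV, conjTranspose_mul, A.inv_conjTranspose, Matrix.mul_assoc, ← Matrix.mul_assoc g, ← hA,
      Matrix.mul_assoc, A.mul_inv, Matrix.mul_one, A.inv_mul]
  have hmem : V ∈ unitary (Matrix (Fin 3) (Fin 3) ℂ) :=
    ⟨conjTranspose_mul_self_of_unitary hVV, hVV⟩
  have hmem' : star V ∈ unitary (Matrix (Fin 3) (Fin 3) ℂ) := Unitary.star_mem hmem
  have h1 : A.1⁻¹ * B.1 * star (A.1⁻¹ * B.1) =
      V * diagonal (fun i => ((d i * d i : ℝ) : ℂ)) * star V := by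
    rw [star_eq_conjTranspose, star_eq_conjTranspose, hV, conjTranspose_mul, conjTranspose_mul,
      A.inv_conjTranspose, B.isHermitian]
    simp only [Matrix.mul_assoc]
    rw [← Matrix.mul_assoc B.1, hB]
    simp only [Matrix.mul_assoc]
  have h2 : ‖A.1⁻¹ * B.1‖ * ‖A.1⁻¹ * B.1‖ = max3 d * max3 d := by
    rw [← CStarRing.norm_self_mul_star, h1, CStarRing.norm_mul_mem_unitary _ hmem',
      CStarRing.norm_mem_unitary_mul _ hmem, l2_opNorm_diagonal, ← max3_mul_self hd]
    have hn : ∀ i, ‖((d i * d i : ℝ) : ℂ)‖ = d i * d i := fun i => by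
      rw [Complex.norm_real, Real.norm_of_nonneg (mul_pos (hd i) (hd i)).le]
    refine le_antisymm ((pi_norm_le_iff_of_nonneg (max3_pos fun i =>
      mul_pos (hd i) (hd i)).le).mpr fun i => ?_) (max3_le fun i => ?_)
    · rw [hn]
      exact le_max3 (fun i => d i * d i) i
    · rw [← hn]
      exact norm_le_pi_norm (fun i => ((d i * d i : ℝ) : ℂ)) i
  exact (mul_self_inj (norm_nonneg _) (max3_pos hd).le).mp h2

/-- The second norm is the first with `A` and `B` exchanged, which replaces the frame `g` by `g D`
and `D` by `D⁻¹`. -/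
theorem distC_eq {A B : XC} {g : Matrix (Fin 3) (Fin 3) ℂ} {d : Fin 3 → ℝ}
    (hd : ∀ i, 0 < d i) (hA : A.1 * A.1 = g * gᴴ)
    (hB : B.1 * B.1 = g * diagonal (fun i => ((d i * d i : ℝ) : ℂ)) * gᴴ) :
    distC A B = Real.log (max3 d) + Real.log (max3 fun i => (d i)⁻¹) := by
  set D : Matrix (Fin 3) (Fin 3) ℂ := diagonal fun i => (d i : ℂ) with hD
  have hDH : Dᴴ = D := isHermitian_diagonal_ofReal d
  have hB' : B.1 * B.1 = (g * D) * (g * D)ᴴ := by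
    rw [hB, conjTranspose_mul, hDH, Matrix.mul_assoc g D, ← Matrix.mul_assoc D D, hD,
      diagonal_mul_diagonal, Matrix.mul_assoc]
    simp
  have hA' : A.1 * A.1 = (g * D) *
      diagonal (fun i => (((d i)⁻¹ * (d i)⁻¹ : ℝ) : ℂ)) * (g * D)ᴴ := by
    rw [hA, conjTranspose_mul, hDH, Matrix.mul_assoc g D, Matrix.mul_assoc g,
      ← Matrix.mul_assoc _ D, hD, diagonal_mul_diagonal, diagonal_mul_diagonal]
    have h1 : (fun i => (d i : ℂ) * (((d i)⁻¹ * (d i)⁻¹ : ℝ) : ℂ) * (d i : ℂ)) = fun _ => 1 := by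
      funext i
      have := (hd i).ne'
      rw [← Complex.ofReal_mul, ← Complex.ofReal_mul, ← Complex.ofReal_one]
      congr 1
      field_simp
    rw [h1, diagonal_one, Matrix.one_mul]
  rw [distC, opNorm_inv_mul hd hA hB, opNorm_inv_mul (fun i => inv_pos.mpr (hd i)) hB' hA']

/-! ### Totally geodesic embeddings -/

theorem exists_argmax_argmin (d : Fin 3 → ℝ) :
    ∃ i j, i ≠ j ∧ (∀ l, d l ≤ d i) ∧ ∀ l, d j ≤ d l := by
  obtain ⟨i, hi⟩ := Finite.exists_max d
  obtain ⟨j, hj⟩ := Finite.exists_min d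
  rcases eq_or_ne i j with rfl | h
  -- Here `d` is constant, so any other index also realizes the minimum.
  · exact ⟨i, i + 1, by fin_cases i <;> decide, hi, fun l => (hi _).trans (hj l)⟩
  · exact ⟨i, j, h, hi, hj⟩

/-- If the distances from `1` to `W` and from `W` to a diagonal element add up, then `W` is
diagonal. -/
theorem eq_diag_of_additive {k q : J ≃ₗ[ℝ] J} (hk : k ∈ F4) (hq : q ∈ E6)
    {d w v : Fin 3 → ℝ} (hd : ∀ i, 0 < d i) (hw : ∀ i, 0 < w i) (hv : ∀ i, 0 < v i) {W : J}
    (hW : W = k (diag fun i => w i * w i)) (hqW : q one = W)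
    (hqd : q (diag fun i => v i * v i) = diag fun i => d i * d i)
    (hadd : Real.log (max3 d) + Real.log (max3 fun i => (d i)⁻¹) =
      Real.log (max3 w) + Real.log (max3 fun i => (w i)⁻¹) +
        (Real.log (max3 v) + Real.log (max3 fun i => (v i)⁻¹))) :
    W = diag (dg W) := by
  have hdp := max3_pos hd
  have hwp := max3_pos hw
  have hvp := max3_pos hv
  have hdp' := max3_pos fun i => inv_pos.mpr (hd i)
  have hwp' := max3_pos fun i => inv_pos.mpr (hw i)
  have hvp' := max3_pos fun i => inv_pos.mpr (hv i)
  obtain ⟨i, j, hij, hi, hj⟩ := exists_argmax_argmin d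
  have ha : max3 d = d i := le_antisymm (max3_le hi) (le_max3 d i)
  have ha' : max3 (fun i => (d i)⁻¹) = (d j)⁻¹ := le_antisymm
    (max3_le fun l => inv_anti₀ (hd j) (hj l)) (le_max3 (fun i => (d i)⁻¹) j)
  set b := max3 w with hb
  set b' := max3 fun i => (w i)⁻¹ with hb'
  set c := max3 v with hc
  set c' := max3 fun i => (v i)⁻¹ with hc'
  have hupper : ∀ (u : Fin 3 → ℝ) l, (∀ i, 0 < u i) → 0 ≤ max3 u * max3 u - u l * u l :=
    fun u l hu => sub_nonneg.mpr (mul_self_le_mul_self (hu l).le (le_max3 u l))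
  have hlower : ∀ (u : Fin 3 → ℝ) l, (∀ i, 0 < u i) →
      0 ≤ u l * u l - (max3 fun i => (u i)⁻¹)⁻¹ * (max3 fun i => (u i)⁻¹)⁻¹ := fun u l hu =>
    sub_nonneg.mpr (mul_self_le_mul_self
      (inv_pos.mpr (max3_pos fun i => inv_pos.mpr (hu i))).le
      (inv_le_of_inv_le₀ (hu l) (le_max3 (fun i => (u i)⁻¹) l)))
  have hsub : ∀ (s : ℝ) (u : Fin 3 → ℝ), diag (fun l => s - u l) = s • one - diag u :=
    fun s u => J_ext (fun i => by simp) fun i => by simp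
  have hsub' : ∀ (s : ℝ) (u : Fin 3 → ℝ), diag (fun l => u l - s) = diag u - s • one :=
    fun s u => J_ext (fun i => by simp) fun i => by simp
  -- In the order of the cone, `b'⁻² ≤ W ≤ b²` and `c'⁻² W ≤ D² ≤ c² W`, where `D` is `diag d`. The
  -- upper bounds are read at the entry where `d` is largest, the lower ones where it is smallest.
  have kup := dg_map_diag_nonneg_of_F4 hk (fun l => hupper w l hw) i
  have klow := dg_map_diag_nonneg_of_F4 hk (fun l => hlower w l hw) j
  have qup := dg_map_diag_nonneg hq (fun l => hupper v l hv) i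
  have qlow := dg_map_diag_nonneg hq (fun l => hlower v l hv) j
  rw [hsub, map_sub, map_smul, hk.2, ← hW] at kup
  rw [hsub', map_sub, map_smul, hk.2, ← hW] at klow
  rw [hsub, map_sub, map_smul, hqW, hqd] at qup
  rw [hsub', map_sub, map_smul, hqW, hqd] at qlow
  simp only [dg_sub, dg_smul, dg_one, dg_diag, off_sub, off_smul, off_one, smul_zero, zero_sub,
    sub_zero, mul_one, neg_eq_zero] at kup klow qup qlow
  rw [← hb] at kup
  rw [← hb'] at klow
  rw [← hc] at qup
  rw [← hc'] at qlow
  have h1 : d i ≤ b * c := by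
    refine (mul_self_le_mul_self_iff (hd i).le (by positivity)).mpr ?_
    nlinarith [mul_le_mul_of_nonneg_left (sub_nonneg.mp kup.1) (mul_self_nonneg c)]
  have h2 : b'⁻¹ * c'⁻¹ ≤ d j := by
    refine (mul_self_le_mul_self_iff (by positivity) (hd j).le).mpr ?_
    nlinarith [mul_le_mul_of_nonneg_left (sub_nonneg.mp klow.1) (mul_self_nonneg c'⁻¹)]
  have h2' : (d j)⁻¹ ≤ b' * c' := by
    have := inv_anti₀ (by positivity) h2
    rwa [mul_inv, inv_inv, inv_inv] at this
  have hprod : d i * (d j)⁻¹ = (b * c) * (b' * c') := by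
    have hdj := inv_pos.mpr (hd j)
    rw [ha, ha', ← Real.log_mul (hd i).ne' hdj.ne', ← Real.log_mul hwp.ne' hwp'.ne',
      ← Real.log_mul hvp.ne' hvp'.ne', ← Real.log_mul (by positivity) (by positivity)] at hadd
    rw [Real.log_injOn_pos (Set.mem_Ioi.mpr (mul_pos (hd i) hdj))
      (Set.mem_Ioi.mpr (by positivity)) hadd]
    ring
  have hdi := hd i
  have hdj := inv_pos.mpr (hd j)
  have e1 : d i = b * c := by
    refine le_antisymm h1 (le_of_mul_le_mul_right ?_ hdj)
    rw [hprod]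
    exact mul_le_mul_of_nonneg_left h2' (by positivity)
  have e2 : d j = b'⁻¹ * c'⁻¹ := by
    have : (d j)⁻¹ = b' * c' := by
      rw [e1] at hprod
      exact mul_left_cancel₀ (by positivity) hprod
    rw [← inv_inv (d j), this, mul_inv]
  -- Additivity makes all these inequalities equalities, so `W` attains an extremal eigenvalue at
  -- entry `i`, and likewise at `j`; its off-diagonal entries there vanish.
  have z1 : b * b - dg W i = 0 := by
    refine le_antisymm ?_ kup.1
    rw [e1] at qup
    have hcc : 0 < c * c := by positivity
    nlinarith
  have z2 : dg W j - b'⁻¹ * b'⁻¹ = 0 := by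
    refine le_antisymm ?_ klow.1
    rw [e2] at qlow
    have hcc : 0 < c'⁻¹ * c'⁻¹ := by positivity
    nlinarith
  have o1 := kup.2 z1
  have o2 := klow.2 z2
  have hoff : ∀ l, off W l = 0 := by
    intro l
    have hl : l = i + 1 ∨ l = i + 2 ∨ l = j + 1 ∨ l = j + 2 := by
      -- Two distinct rows meet all three off-diagonal positions.
      have key : ∀ i j l : Fin 3, i ≠ j → l = i + 1 ∨ l = i + 2 ∨ l = j + 1 ∨ l = j + 2 := by
        decide
      exact key i j l hij
    rcases hl with rfl | rfl | rfl | rfl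
    exacts [o1.1, o1.2, o2.1, o2.2]
  exact J_ext (fun l => by simp) fun l => by simp [hoff l]

theorem isTotallyGeodesicEmbedding {e : Octonion} (he : e.IsImaginaryUnit) {g₀ : J ≃ₗ[ℝ] J}
    (hg₀ : g₀ ∈ E6) {φ : XC → XO}
    (hφ : ∀ A, jmul (φ A).1 (φ A).1 = g₀ (ofMatrix e (A.1 * A.1))) :
    IsTotallyGeodesicEmbedding φ where
  isometric A B := by
    obtain ⟨g, d, hd, hprod, hA, hB⟩ := exists_relative_position_XC A B
    obtain ⟨h, hh, h1, h2⟩ := exists_E6_ofMatrix_mul he g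
    rw [distC_eq hd hA hB]
    refine distO_eq (E6.mul_mem hg₀ hh) hd hprod ?_ ?_
    · rw [hφ, hA, LinearEquiv.mul_apply, h1]
    · rw [hφ, hB, LinearEquiv.mul_apply, h2]
  map_geodesicLine γ := by
    rintro ⟨g, a, ha, hγ⟩
    obtain ⟨h, hh, -, h2⟩ := exists_E6_ofMatrix_mul he g
    refine ⟨⟨g₀ * h, E6.mul_mem hg₀ hh⟩, a, ha, fun t => ?_⟩
    have ht := hγ t
    rw [IsActC, diagonal_mul_diagonal] at ht
    rw [IsActO, jmul_diag_diag, LinearEquiv.mul_apply, h2, Function.comp_apply, hφ, ht]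
    simp only [Complex.ofReal_mul]
  geodesicSegment_subset A B γ L := by
    rintro ⟨hL, h0, h1, hdist⟩ t ht
    obtain ⟨g, d, hd, hprod, hA, hB⟩ := exists_relative_position_XC A B
    obtain ⟨h, hh, hh1, hh2⟩ := exists_E6_ofMatrix_mul he g
    have hG := E6.mul_mem hg₀ hh
    have hGA : jmul (φ A).1 (φ A).1 = (g₀ * h) one := by
      rw [hφ, hA, LinearEquiv.mul_apply, hh1]
    have hGB : jmul (φ B).1 (φ B).1 = (g₀ * h) (diag fun i => d i * d i) := by
      rw [hφ, hB, LinearEquiv.mul_apply, hh2]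
    obtain ⟨k, hk, w, hw, hwprod, hZ⟩ := exists_relative_position hG (γ t)
    obtain ⟨g₂, hg₂, hZ₂⟩ := exists_E6_jmul_self (γ t)
    obtain ⟨k₂, hk₂, v, hv, hvprod, hB₂⟩ := exists_relative_position hg₂ (φ B)
    have hZ₂' : jmul (γ t).1 (γ t).1 = (g₂ * k₂) one := by
      rw [hZ₂, LinearEquiv.mul_apply, hk₂.2]
    have d1 := distO_eq hG hd hprod hGA hGB
    have d2 := distO_eq (E6.mul_mem hG hk.1) hw hwprod
      (by rw [hGA, LinearEquiv.mul_apply (f := g₀ * h), hk.2]) hZ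
    have d3 := distO_eq (E6.mul_mem hg₂ hk₂.1) hv hvprod hZ₂' hB₂
    have s1 := hdist 0 ⟨le_rfl, hL⟩ L ⟨hL, le_rfl⟩
    have s2 := hdist 0 ⟨le_rfl, hL⟩ t ht
    have s3 := hdist t ht L ⟨hL, le_rfl⟩
    rw [h0, h1, d1, zero_sub, abs_neg, abs_of_nonneg hL] at s1
    rw [h0, d2, zero_sub, abs_neg, abs_of_nonneg ht.1] at s2
    rw [h1, d3, abs_sub_comm, abs_of_nonneg (sub_nonneg.mpr ht.2)] at s3
    -- In the frame `g₀ * h` the endpoints become `I` and a diagonal matrix, and the three distances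
    -- add up along the segment. The square of `γ t` is thus diagonal in this frame, hence complex.
    have hW := eq_diag_of_additive hk (E6.mul_mem (E6.inv_mem hG) (E6.mul_mem hg₂ hk₂.1)) hd hw hv
      rfl (by
        rw [LinearEquiv.mul_apply, ← hZ₂', hZ]
        exact (g₀ * h).symm_apply_apply _)
      (by
        rw [LinearEquiv.mul_apply, LinearEquiv.mul_apply (f := g₂), ← hB₂, hGB]
        exact (g₀ * h).symm_apply_apply _)
      (by rw [s1, s2, s3]; ring)
    rw [hW, LinearEquiv.mul_apply, hh2] at hZ
    obtain ⟨C, hC⟩ := exists_XC_mul_self he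
      (isHermitian_mul_mul_conjTranspose g.1 (isHermitian_diagonal_ofReal _))
      (E6.mul_mem (E6.inv_mem hg₀) hg₂) (by
        rw [LinearEquiv.mul_apply, ← hZ₂, hZ]
        exact (g₀.symm_apply_apply _).symm)
    refine ⟨C, XO_ext ?_⟩
    rw [hφ, hC, hZ]

/-! ### Construction of the embeddings and of points in their image -/

theorem exists_map_XC {e : Octonion} (he : e.IsImaginaryUnit) {g₀ : J ≃ₗ[ℝ] J}
    (hg₀ : g₀ ∈ E6) :
    ∃ φ : XC → XO, ∀ A, jmul (φ A).1 (φ A).1 = g₀ (ofMatrix e (A.1 * A.1)) := by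
  have h : ∀ A : XC, ∃ N : XO, jmul N.1 N.1 = g₀ (ofMatrix e (A.1 * A.1)) := fun A => by
    -- The matrix `A` is itself an element of `SL₃(ℂ)`, and `A² = A Aᴴ` is its action on the
    -- identity.
    obtain ⟨h, hh, h1, -⟩ := exists_E6_ofMatrix_mul he ⟨A.1, A.2.2⟩
    obtain ⟨N, hN⟩ := exists_XO_jmul_self (E6.mul_mem hg₀ hh)
    refine ⟨N, ?_⟩
    rw [hN, LinearEquiv.mul_apply, h1, A.isHermitian]
  exact ⟨fun A => (h A).choose, fun A => (h A).choose_spec⟩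

theorem mem_range_of_jmul_self {e : Octonion} (he : e.IsImaginaryUnit) {g₀ : J ≃ₗ[ℝ] J}
    (hg₀ : g₀ ∈ E6) {φ : XC → XO}
    (hφ : ∀ A, jmul (φ A).1 (φ A).1 = g₀ (ofMatrix e (A.1 * A.1)))
    {B : Matrix (Fin 3) (Fin 3) ℂ} (hB : B.IsHermitian) {x : XO}
    (hx : jmul x.1 x.1 = g₀ (ofMatrix e B)) : x ∈ Set.range φ := by
  obtain ⟨h, hh, h1⟩ := exists_E6_jmul_self x
  obtain ⟨A, hA⟩ := exists_XC_mul_self he hB (E6.mul_mem (E6.inv_mem hg₀) hh) (by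
    rw [LinearEquiv.mul_apply, ← h1, hx]
    exact (g₀.symm_apply_apply _).symm)
  exact ⟨A, XO_ext (by rw [hφ, hA, hx])⟩

end FreudenthalE6

end

/-! ### Three points in a common complex form -/

open FreudenthalE6 in
theorem proposition2p9 (x y z : FreudenthalE6.XO) :
    ∃ φ : FreudenthalE6.XC → FreudenthalE6.XO,
      FreudenthalE6.IsTotallyGeodesicEmbedding φ ∧
        x ∈ Set.range φ ∧ y ∈ Set.range φ ∧ z ∈ Set.range φ := by
  obtain ⟨g, hg, hx⟩ := exists_E6_jmul_self x
  obtain ⟨k, hk, d, -, -, hy⟩ := exists_relative_position hg y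
  have hgk := E6.mul_mem hg hk.1
  -- In the frame `g * k` the squares of `x` and `y` are `I` and a diagonal matrix; `s` makes that
  -- of `z` complex and fixes both of these.
  obtain ⟨s, hs, e, he, B, hB, hz⟩ := exists_spin_ofMatrix ((g * k)⁻¹ (jmul z.1 z.1))
  have hg₀ : g * k * s⁻¹ ∈ E6 := E6.mul_mem hgk (E6.inv_mem hs.1)
  have hdiag : ∀ d, (g * k * s⁻¹) (diag d) = (g * k) (diag d) := fun d =>
    congrArg (g * k) ((spinGroup.inv_mem hs).2 d)
  obtain ⟨φ, hφ⟩ := exists_map_XC he hg₀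
  refine ⟨φ, isTotallyGeodesicEmbedding he hg₀ hφ, ?_, ?_, ?_⟩
  · refine mem_range_of_jmul_self he hg₀ hφ Matrix.isHermitian_one ?_
    rw [ofMatrix_one, one, hdiag, hx]
    exact congrArg g hk.2.symm
  · refine mem_range_of_jmul_self he hg₀ hφ
      (isHermitian_diagonal_ofReal fun i => d i * d i) ?_
    rw [ofMatrix_diagonal, hdiag, hy, LinearEquiv.mul_apply]
  · refine mem_range_of_jmul_self he hg₀ hφ hB ?_
    rw [← hz]
    change _ = (g * k) (s.symm (s _))
    rw [LinearEquiv.symm_apply_apply]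
    exact ((g * k).apply_symm_apply _).symm
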